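/- Let $I,J\subset\mathbb R$ be non-empty open intervals and let $\alpha:I\to\mathbb R^3$, $\beta:J\to\mathbb R^3$ be $C^\infty$ curves parameterized by arc length, with curvatures $\kappa_\alpha,\kappa_\beta$ positive everywhere and torsions $\tau_\alpha,\tau_\beta$ nonzero everywhere (sign convention $\mathbf n'=-\kappa\mathbf t+\tau\mathbf b$). Suppose that $\Psi(s,t)=\alpha(s)+\beta(t)$, $(s,t)\in I\times J$, is a regular parameterized surface (that is, $\alpha'(s)\times\beta'(t)\neq 0$ for all $s,t$) whose mean curvature vanishes identically. For a curve with curvature $\kappa>0$ and torsion $\tau$ put $\Sigma=(\kappa'/\kappa)'+\kappa^2-\tau^2$. Then there are constants $c_1\ne0$, $c_2$, $c_3\in\mathbb R$ such that the following hold. 1. On $I$ and $J$, respectively, $$\kappa_\alpha^2\tau_\alpha=\kappa_\beta^2\tau_\beta=c_1,\qquad \frac{\Sigma_\alpha}{\tau_\alpha}-\tau_\alpha=\frac{\Sigma_\beta}{\tau_\beta}-\tau_\beta=c_2 .$$ 2. $\kappa_\alpha$ and $\kappa_\beta$ are positive solutions of $$y'^2+y^4+c_3y^2+\frac{c_1^2}{y^2}+c_1c_2=0,$$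 and the two curves have the same orbit up to translation: there are a $C^\infty$ curve $\gamma:\mathbb R\to\mathbb R^3$ parameterized by arc length, whose curvature $\kappa_\gamma$ is positive and solves the same equation on all of $\mathbb R$ and whose torsion is $c_1/\kappa_\gamma^2$, a sign $\varepsilon\in\{1,-1\}$, a number $t_1\in\mathbb R$ and a vector $v\in\mathbb R^3$ such that $$\alpha(s)=\gamma(s)\ (s\in I),\qquad \beta(t)=\gamma(\varepsilon t+t_1)+v\ (t\in J);$$ in particular $\kappa_\alpha(s)=\kappa_\gamma(s)$ and $\kappa_\beta(t)=\kappa_\gamma(\varepsilon t+t_1)$. 3. The cubic polynomial $-\lambda^3+c_2\lambda^2-c_3\lambda+c_1$ has three real roots (with multiplicity) $\lambda_1,\lambda_2,\lambda_3$, which can be numbered so that $\lambda_1\le\lambda_2<0<\lambda_3$ if $c_1>0$, and $\lambda_1\ge\lambda_2>0>\lambda_3$ if $c_1<0$. Put $$A=\sqrt{\frac{\lambda_3}{\lambda_3-\lambda_1}},\qquad B=\sqrt{\frac{\lambda_3}{\lambda_3-\lambda_2}} .$$ After applying to $\alpha$ and to $\beta$ suitable rigid motions (isometries of $\mathbb R^3$),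 with linear parts $M_\alpha$ and $M_\beta=\operatorname{diag}(1,\varepsilon,\varepsilon)M_\alpha$, where $\varepsilon$ is the sign in item 2 and $\det M_\alpha=1$ if $c_1>0$, $\det M_\alpha=-1$ if $c_1<0$, one has $$\alpha(s)=\left(A\int_{s_0}^s\cos w_\alpha,\ B\int_{s_0}^s\sin w_\alpha,\ \int_{s_0}^s\sqrt{1-A^2\cos^2w_\alpha-B^2\sin^2w_\alpha}\right),$$ $$\beta(t)=\left(A\int_{t_0}^t\cos w_\beta,\ B\int_{t_0}^t\sin w_\beta,\ \int_{t_0}^t\sqrt{1-A^2\cos^2w_\beta-B^2\sin^2w_\beta}\right)$$ on $I$ and $J$, where the functions $w_\alpha$, $w_\beta$ are antiderivatives of $\sqrt{\kappa_\alpha^2+\lambda_1\lambda_2}$ on $I$ and of $\sqrt{\kappa_\beta^2+\lambda_1\lambda_2}$ on $J$, and $s_0\in I$, $t_0\in J$ are arbitrary base points (a change of base point only changes the translational part of the rigid motion). -/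

import Mathlib

open scoped ContDiff

noncomputable section

namespace TranslationSurface

/-- Euclidean three-space. -/
abbrev E3 : Type := EuclideanSpace ℝ (Fin 3)

/-- The vector product of Euclidean three-space. -/
def cross (u v : E3) : E3 := WithLp.toLp 2 (crossProduct u.ofLp v.ofLp)

/-! ### Space curves parameterized by arc length -/

/-- A smooth curve, defined on the (open) set `I` of parameters, parameterized by arc length.
Values outside `I` are irrelevant. -/
structure IsArcLengthCurve (α : ℝ → E3) (I : Set ℝ) : Prop where
  smooth : ContDiffOn ℝ ∞ α I
  unit_speed : ∀ s ∈ I, ‖deriv α s‖ = 1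

/-- The unit tangent vector of a curve parameterized by arc length. -/
def tangent (α : ℝ → E3) (s : ℝ) : E3 := deriv α s

/-- The curvature of a curve parameterized by arc length. -/
def curvature (α : ℝ → E3) (s : ℝ) : ℝ := ‖deriv (tangent α) s‖

/-- The principal normal vector (meaningful where the curvature is positive). -/
def normal (α : ℝ → E3) (s : ℝ) : E3 := (curvature α s)⁻¹ • deriv (tangent α) s

/-- The binormal vector. -/
def binormal (α : ℝ → E3) (s : ℝ) : E3 := cross (tangent α s) (normal α s)

/-- The torsion, with the sign convention `n' = -κ t + τ b`, `b' = -τ n`. -/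
def torsion (α : ℝ → E3) (s : ℝ) : ℝ := inner ℝ (deriv (normal α) s) (binormal α s)

/-- `Σ = (κ'/κ)' + κ² - τ²`. -/
def bigSigma (α : ℝ → E3) (s : ℝ) : ℝ :=
  deriv (fun u => deriv (curvature α) u / curvature α u) s + curvature α s ^ 2 - torsion α s ^ 2

/-- The function `y` satisfies `y'² + y⁴ + c₃ y² + c₁²/y² + c₁c₂ = 0` at the point `s`. -/
def SolvesODEAt (c₁ c₂ c₃ : ℝ) (y : ℝ → ℝ) (s : ℝ) : Prop :=
  deriv y s ^ 2 + y s ^ 4 + c₃ * y s ^ 2 + c₁ ^ 2 / y s ^ 2 + c₁ * c₂ = 0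

/-! ### Parameterized surfaces -/

/-- First partial derivative in the first variable. -/
def dS (Ψ : ℝ → ℝ → E3) (s t : ℝ) : E3 := deriv (fun u => Ψ u t) s

/-- First partial derivative in the second variable. -/
def dT (Ψ : ℝ → ℝ → E3) (s t : ℝ) : E3 := deriv (fun v => Ψ s v) t

/-- The unit normal vector field. -/
def gaussNormal (Ψ : ℝ → ℝ → E3) (s t : ℝ) : E3 :=
  ‖cross (dS Ψ s t) (dT Ψ s t)‖⁻¹ • cross (dS Ψ s t) (dT Ψ s t)

/-- The mean curvature `H = (lG - 2mF + nE) / (2(EG - F²))`, computed from the coefficients of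
the first and the second fundamental form. -/
def meanCurvature (Ψ : ℝ → ℝ → E3) (s t : ℝ) : ℝ :=
  let E := inner ℝ (dS Ψ s t) (dS Ψ s t)
  let F := inner ℝ (dS Ψ s t) (dT Ψ s t)
  let G := inner ℝ (dT Ψ s t) (dT Ψ s t)
  let l := inner ℝ (gaussNormal Ψ s t) (dS (dS Ψ) s t)
  let m := inner ℝ (gaussNormal Ψ s t) (dT (dS Ψ) s t)
  let n := inner ℝ (gaussNormal Ψ s t) (dT (dT Ψ) s t)
  (l * G - 2 * m * F + n * E) / (2 * (E * G - F ^ 2))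

/-- `Ψ` is a regular parameterized surface on `I × J` with zero mean curvature everywhere. -/
structure IsMinimalSurface (Ψ : ℝ → ℝ → E3) (I J : Set ℝ) : Prop where
  regular : ∀ s ∈ I, ∀ t ∈ J, cross (dS Ψ s t) (dT Ψ s t) ≠ 0
  meanCurvature_eq_zero : ∀ s ∈ I, ∀ t ∈ J, meanCurvature Ψ s t = 0

/-! ### The normal form of the generating curves -/

/-- The cubic polynomial `-λ³ + c₂λ² - c₃λ + c₁`. -/
def cubic (c₁ c₂ c₃ : ℝ) : Polynomial ℝ :=
  -Polynomial.X ^ 3 + Polynomial.C c₂ * Polynomial.X ^ 2 - Polynomial.C c₃ * Polynomial.X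
    + Polynomial.C c₁

/-- The curve
`(A ∫ cos w, B ∫ sin w, ∫ √(1 - A² cos² w - B² sin² w))`, with integrals from `s₀` to `s`. -/
def modelCurve (A B : ℝ) (w : ℝ → ℝ) (s₀ s : ℝ) : E3 :=
  !₂[A * ∫ u in s₀..s, Real.cos (w u),
     B * ∫ u in s₀..s, Real.sin (w u),
     ∫ u in s₀..s, √(1 - A ^ 2 * Real.cos (w u) ^ 2 - B ^ 2 * Real.sin (w u) ^ 2)]

/-- On `I`, a rigid motion with linear part `M` carries `α` to the model curve with
`A = √(l₃/(l₃ - l₁))`, `B = √(l₃/(l₃ - l₂))` and `w = ∫ √(κ² + l₁l₂)`, where `κ` is the curvature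
of `α`. The constants of integration are the values of `w` and the translation vector `a`. -/
def HasNormalForm (l₁ l₂ l₃ : ℝ) (M : E3 ≃ₗᵢ[ℝ] E3) (α : ℝ → E3) (I : Set ℝ) : Prop :=
  ∃ w : ℝ → ℝ,
    (∀ s₀ ∈ I, ∀ s ∈ I, w s = w s₀ + ∫ u in s₀..s, √(curvature α u ^ 2 + l₁ * l₂)) ∧
    ∀ s₀ ∈ I, ∃ a : E3, ∀ s ∈ I,
      M (α s) + a = modelCurve √(l₃ / (l₃ - l₁)) √(l₃ / (l₃ - l₂)) w s₀ s

end TranslationSurface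

end

open scoped ContDiff

noncomputable section

namespace TranslationSurface

/-! ### Vector algebra -/

@[simp] lemma cross_zero (u v : E3) : cross u v 0 = u 1 * v 2 - u 2 * v 1 := by
  simp [cross, crossProduct]

@[simp] lemma cross_one (u v : E3) : cross u v 1 = u 2 * v 0 - u 0 * v 2 := by
  simp [cross, crossProduct]

@[simp] lemma cross_two (u v : E3) : cross u v 2 = u 0 * v 1 - u 1 * v 0 := by
  simp [cross, crossProduct]

lemma inner_eq (u v : E3) : inner ℝ u v = u 0 * v 0 + u 1 * v 1 + u 2 * v 2 := by
  simp [PiLp.inner_apply, Fin.sum_univ_three, mul_comm]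

lemma ext3 {u v : E3} (h0 : u 0 = v 0) (h1 : u 1 = v 1) (h2 : u 2 = v 2) : u = v := by
  ext i; fin_cases i <;> assumption

lemma inner_cross_left (u v : E3) : inner ℝ u (cross u v) = (0 : ℝ) := by
  simp [inner_eq]; ring

lemma inner_cross_right (u v : E3) : inner ℝ v (cross u v) = (0 : ℝ) := by
  simp [inner_eq]; ring

lemma cross_swap (u v : E3) : cross u v = -cross v u := by
  apply ext3 <;> simp <;> ring

lemma cross_self (u : E3) : cross u u = 0 := by
  simp [cross]

lemma cross_smul_right (a : ℝ) (u v : E3) : cross u (a • v) = a • cross u v := by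
  apply ext3 <;> simp <;> ring

lemma cross_smul_left (a : ℝ) (u v : E3) : cross (a • u) v = a • cross u v := by
  apply ext3 <;> simp <;> ring

lemma cross_add_right (u v w : E3) : cross u (v + w) = cross u v + cross u w := by
  apply ext3 <;> simp <;> ring

lemma inner_cross_cross (u v : E3) :
    inner ℝ (cross u v) (cross u v) =
      (inner ℝ u u * inner ℝ v v - inner ℝ u v ^ 2 : ℝ) := by
  simp only [inner_eq, cross_zero, cross_one, cross_two]; ring

lemma cross_cross_right (u v w : E3) :
    cross u (cross v w) = (inner ℝ u w : ℝ) • v - (inner ℝ u v : ℝ) • w := by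
  apply ext3 <;> simp [inner_eq] <;> ring

/-- The vector product as a bilinear map. -/
def crossLin : E3 →ₗ[ℝ] E3 →ₗ[ℝ] E3 :=
  LinearMap.mk₂ ℝ cross
    (fun u v w => by apply ext3 <;> simp <;> ring)
    (fun a u v => cross_smul_left a u v)
    (fun u v w => cross_add_right u v w)
    (fun a u v => cross_smul_right a u v)

lemma hasDerivAt_cross {u v : ℝ → E3} {u' v' : E3} {s : ℝ} (hu : HasDerivAt u u' s)
    (hv : HasDerivAt v v' s) :
    HasDerivAt (fun r => cross (u r) (v r)) (cross (u s) v' + cross u' (v s)) s :=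
  crossLin.toContinuousBilinearMap.hasDerivAt_of_bilinear (fun _ => hu) (fun _ => hv)

/-- A linear isometry maps vector products to vector products, up to its determinant. -/
lemma map_cross (M : E3 ≃ₗᵢ[ℝ] E3) (u v : E3) :
    cross (M u) (M v)
      = LinearMap.det (M.toLinearEquiv : E3 →ₗ[ℝ] E3) • M (cross u v) := by
  have key : ∀ (u v w : E3), inner ℝ (M w) (cross (M u) (M v))
      = LinearMap.det (M.toLinearEquiv : E3 →ₗ[ℝ] E3) * inner ℝ w (cross u v) := by
    intro u v w
    set b := (EuclideanSpace.basisFun (Fin 3) ℝ).toBasis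
    have hdet : ∀ u v w : E3, inner ℝ w (cross u v) = b.det ![w, u, v] := by
      intro u v w
      rw [Module.Basis.det_apply, Matrix.det_fin_three]
      simp [b, Module.Basis.toMatrix_apply, inner_eq]
      ring
    have := b.det_comp (M.toLinearEquiv : E3 →ₗ[ℝ] E3) ![w, u, v]
    rw [hdet, hdet, ← this]
    congr 1
    ext i; fin_cases i <;> rfl
  refine ext_inner_left ℝ fun w => ?_
  obtain ⟨w, rfl⟩ := M.surjective w
  rw [key, inner_smul_right, M.inner_map_map]

/-! ### The Frenet frame -/

section Frenet

variable {α : ℝ → E3} {I : Set ℝ}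

lemma IsArcLengthCurve.contDiffOn_tangent (hα : IsArcLengthCurve α I) (hI : IsOpen I) :
    ContDiffOn ℝ ∞ (tangent α) I :=
  ((contDiffOn_infty_iff_deriv_of_isOpen hI).1 hα.smooth).2

lemma IsArcLengthCurve.contDiffOn_deriv_tangent (hα : IsArcLengthCurve α I) (hI : IsOpen I) :
    ContDiffOn ℝ ∞ (deriv (tangent α)) I :=
  ((contDiffOn_infty_iff_deriv_of_isOpen hI).1 (hα.contDiffOn_tangent hI)).2

lemma IsArcLengthCurve.contDiffOn_curvature (hα : IsArcLengthCurve α I) (hI : IsOpen I)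
    (hκ : ∀ s ∈ I, 0 < curvature α s) : ContDiffOn ℝ ∞ (curvature α) I :=
  (hα.contDiffOn_deriv_tangent hI).norm ℝ fun s hs => norm_pos_iff.1 (hκ s hs)

lemma IsArcLengthCurve.contDiffOn_normal (hα : IsArcLengthCurve α I) (hI : IsOpen I)
    (hκ : ∀ s ∈ I, 0 < curvature α s) : ContDiffOn ℝ ∞ (normal α) I :=
  ((hα.contDiffOn_curvature hI hκ).inv fun s hs => (hκ s hs).ne').smul
    (hα.contDiffOn_deriv_tangent hI)

lemma _root_.ContDiffOn.hasDerivAt_of_isOpen {F : Type*} [NormedAddCommGroup F] [NormedSpace ℝ F]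
    {f : ℝ → F} (hf : ContDiffOn ℝ ∞ f I) (hI : IsOpen I) {s : ℝ}
    (hs : s ∈ I) : HasDerivAt f (deriv f s) s :=
  ((hf.contDiffAt (hI.mem_nhds hs)).differentiableAt (by simp)).hasDerivAt

lemma IsArcLengthCurve.hasDerivAt (hα : IsArcLengthCurve α I) (hI : IsOpen I) {s : ℝ}
    (hs : s ∈ I) : HasDerivAt α (tangent α s) s :=
  ContDiffOn.hasDerivAt_of_isOpen hα.smooth hI hs

/-- If two differentiable functions agree on an open set, so do their derivatives. -/
lemma eq_of_hasDerivAt_of_eqOn {F : Type*} [NormedAddCommGroup F] [NormedSpace ℝ F]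
    {f g : ℝ → F} {f' g' : F} (hI : IsOpen I) (h : ∀ s ∈ I, f s = g s) {s : ℝ} (hs : s ∈ I)
    (hf : HasDerivAt f f' s) (hg : HasDerivAt g g' s) : f' = g' :=
  (hf.congr_of_eventuallyEq
    (Filter.eventuallyEq_of_mem (hI.mem_nhds hs) fun r hr => (h r hr).symm)).unique hg

lemma IsArcLengthCurve.inner_tangent_self (hα : IsArcLengthCurve α I) {s : ℝ} (hs : s ∈ I) :
    inner ℝ (tangent α s) (tangent α s) = (1 : ℝ) := by
  rw [real_inner_self_eq_norm_sq, tangent, hα.unit_speed s hs, one_pow]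

lemma deriv_tangent_eq {s : ℝ} (hκ : 0 < curvature α s) :
    deriv (tangent α) s = curvature α s • normal α s := by
  rw [normal, smul_inv_smul₀ hκ.ne']

lemma IsArcLengthCurve.hasDerivAt_tangent (hα : IsArcLengthCurve α I) (hI : IsOpen I)
    (hκ : ∀ s ∈ I, 0 < curvature α s) {s : ℝ} (hs : s ∈ I) :
    HasDerivAt (tangent α) (curvature α s • normal α s) s := by
  rw [← deriv_tangent_eq (hκ s hs)]
  exact ContDiffOn.hasDerivAt_of_isOpen (hα.contDiffOn_tangent hI) hI hs

lemma inner_normal_self {s : ℝ} (hκ : 0 < curvature α s) :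
    inner ℝ (normal α s) (normal α s) = (1 : ℝ) := by
  rw [real_inner_self_eq_norm_sq, normal, norm_smul, norm_inv, Real.norm_of_nonneg hκ.le,
    ← curvature, inv_mul_cancel₀ hκ.ne', one_pow]

lemma IsArcLengthCurve.inner_tangent_normal (hα : IsArcLengthCurve α I) (hI : IsOpen I)
    (hκ : ∀ s ∈ I, 0 < curvature α s) {s : ℝ} (hs : s ∈ I) :
    inner ℝ (tangent α s) (normal α s) = (0 : ℝ) := by
  have h := eq_of_hasDerivAt_of_eqOn hI (fun r hr => hα.inner_tangent_self hr) hs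
    ((hα.hasDerivAt_tangent hI hκ hs).inner ℝ (hα.hasDerivAt_tangent hI hκ hs))
    (hasDerivAt_const s (1 : ℝ))
  rw [real_inner_comm, ← two_mul, inner_smul_left, real_inner_comm] at h
  simpa [(hκ s hs).ne'] using h

/-- The Frenet frame as an orthonormal basis. -/
lemma IsArcLengthCurve.exists_frenetBasis (hα : IsArcLengthCurve α I) (hI : IsOpen I)
    (hκ : ∀ s ∈ I, 0 < curvature α s) {s : ℝ} (hs : s ∈ I) :
    ∃ b : OrthonormalBasis (Fin 3) ℝ E3,
      b 0 = tangent α s ∧ b 1 = normal α s ∧ b 2 = binormal α s := by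
  have h1 := hα.inner_tangent_self hs
  have h2 := inner_normal_self (hκ s hs)
  have h3 := hα.inner_tangent_normal hI hκ hs
  have h4 := inner_cross_left (tangent α s) (normal α s)
  have h5 := inner_cross_right (tangent α s) (normal α s)
  have h6 : inner ℝ (binormal α s) (binormal α s) = (1 : ℝ) := by
    rw [binormal, inner_cross_cross, h1, h2, h3]; norm_num
  have ho : Orthonormal ℝ ![tangent α s, normal α s, binormal α s] := by
    rw [orthonormal_iff_ite]
    intro i j
    have h3' := h3
    have h4' := h4
    have h5' := h5
    rw [real_inner_comm] at h3' h4' h5'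
    fin_cases i <;> fin_cases j <;> first
      | exact h1 | exact h2 | exact h3 | exact h4 | exact h5 | exact h6
      | exact h3' | exact h4' | exact h5'
  have hsp : ⊤ ≤ Submodule.span ℝ (Set.range ![tangent α s, normal α s, binormal α s]) := by
    have := (basisOfOrthonormalOfCardEqFinrank ho (by simp)).span_eq
    rw [coe_basisOfOrthonormalOfCardEqFinrank] at this
    exact this.ge
  refine ⟨OrthonormalBasis.mk ho hsp, ?_, ?_, ?_⟩ <;> simp [OrthonormalBasis.coe_mk]

lemma IsArcLengthCurve.frenet_expand (hα : IsArcLengthCurve α I) (hI : IsOpen I)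
    (hκ : ∀ s ∈ I, 0 < curvature α s) {s : ℝ} (hs : s ∈ I) (v : E3) :
    v = (inner ℝ (tangent α s) v : ℝ) • tangent α s + (inner ℝ (normal α s) v : ℝ) • normal α s
      + (inner ℝ (binormal α s) v : ℝ) • binormal α s := by
  obtain ⟨b, h0, h1, h2⟩ := hα.exists_frenetBasis hI hκ hs
  have := b.sum_repr' v
  rw [Fin.sum_univ_three, h0, h1, h2] at this
  exact this.symm

lemma IsArcLengthCurve.hasDerivAt_normal (hα : IsArcLengthCurve α I) (hI : IsOpen I)
    (hκ : ∀ s ∈ I, 0 < curvature α s) {s : ℝ} (hs : s ∈ I) :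
    HasDerivAt (normal α)
      (-curvature α s • tangent α s + torsion α s • binormal α s) s := by
  have hn := ContDiffOn.hasDerivAt_of_isOpen (hα.contDiffOn_normal hI hκ) hI hs
  have h1 := eq_of_hasDerivAt_of_eqOn hI (fun r hr => inner_normal_self (hκ r hr)) hs
    (hn.inner ℝ hn) (hasDerivAt_const s (1 : ℝ))
  rw [real_inner_comm (normal α s)] at h1
  have h2 := eq_of_hasDerivAt_of_eqOn hI (fun r hr => hα.inner_tangent_normal hI hκ hr) hs
    ((hα.hasDerivAt_tangent hI hκ hs).inner ℝ hn) (hasDerivAt_const s (0 : ℝ))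
  rw [inner_smul_left, inner_normal_self (hκ s hs)] at h2
  have h3 : inner ℝ (tangent α s) (deriv (normal α) s) = -curvature α s := by
    simp at h2; linarith
  have h4 : inner ℝ (normal α s) (deriv (normal α) s) = (0 : ℝ) := by
    linarith
  have h5 : inner ℝ (binormal α s) (deriv (normal α) s) = torsion α s := by
    rw [real_inner_comm]; rfl
  have := hα.frenet_expand hI hκ hs (deriv (normal α) s)
  rw [h3, h4, h5, zero_smul, add_zero] at this
  rwa [this] at hn

lemma IsArcLengthCurve.hasDerivAt_binormal (hα : IsArcLengthCurve α I) (hI : IsOpen I)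
    (hκ : ∀ s ∈ I, 0 < curvature α s) {s : ℝ} (hs : s ∈ I) :
    HasDerivAt (binormal α) (-torsion α s • normal α s) s := by
  have h := hasDerivAt_cross (hα.hasDerivAt_tangent hI hκ hs) (hα.hasDerivAt_normal hI hκ hs)
  refine h.congr_deriv ?_
  rw [cross_add_right, cross_smul_right, cross_smul_right, cross_self, cross_smul_left,
    cross_self, binormal, cross_cross_right, hα.inner_tangent_normal hI hκ hs,
    hα.inner_tangent_self hs]
  simp

/-- A curve with nonvanishing torsion has tangent vectors spanning the space. -/
lemma IsArcLengthCurve.span_tangent (hα : IsArcLengthCurve α I) (hI : IsOpen I)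
    (hIne : I.Nonempty) (hκ : ∀ s ∈ I, 0 < curvature α s) (hτ : ∀ s ∈ I, torsion α s ≠ 0) :
    Submodule.span ℝ (tangent α '' I) = ⊤ := by
  rw [← Submodule.orthogonal_eq_bot_iff, Submodule.eq_bot_iff]
  intro v hv
  have h1 : ∀ s ∈ I, inner ℝ (tangent α s) v = (0 : ℝ) := fun s hs =>
    hv _ (Submodule.subset_span ⟨s, hs, rfl⟩)
  have h2 : ∀ s ∈ I, inner ℝ (normal α s) v = (0 : ℝ) := fun s hs => by
    have := eq_of_hasDerivAt_of_eqOn hI h1 hs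
      ((hα.hasDerivAt_tangent hI hκ hs).inner ℝ (hasDerivAt_const s v))
      (hasDerivAt_const s (0 : ℝ))
    rw [inner_smul_left, inner_zero_right, zero_add] at this
    exact (mul_eq_zero.1 this).resolve_left (hκ s hs).ne'
  have h3 : ∀ s ∈ I, inner ℝ (binormal α s) v = (0 : ℝ) := fun s hs => by
    have := eq_of_hasDerivAt_of_eqOn hI h2 hs
      ((hα.hasDerivAt_normal hI hκ hs).inner ℝ (hasDerivAt_const s v))
      (hasDerivAt_const s (0 : ℝ))
    rw [inner_zero_right, zero_add, inner_add_left, inner_smul_left, inner_smul_left, h1 s hs,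
      mul_zero, zero_add] at this
    exact (mul_eq_zero.1 this).resolve_left (hτ s hs)
  obtain ⟨s, hs⟩ := hIne
  rw [hα.frenet_expand hI hκ hs v, h1 s hs, h2 s hs, h3 s hs]
  simp

end Frenet

/-! ### Curves whose tangent vectors satisfy `t × t' = L t` for a linear map `L` -/

section LinearRelation

variable {α : ℝ → E3} {I : Set ℝ} {L : E3 →ₗ[ℝ] E3}

lemma hasDerivAt_map (L : E3 →ₗ[ℝ] E3) {u : ℝ → E3} {u' : E3} {s : ℝ} (hu : HasDerivAt u u' s) :
    HasDerivAt (fun r => L (u r)) (L u') s :=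
  (LinearMap.toContinuousLinearMap L).hasFDerivAt.comp_hasDerivAt s hu

/-- The inner products of the Frenet vectors. -/
lemma IsArcLengthCurve.frenet_inner (hα : IsArcLengthCurve α I) (hI : IsOpen I)
    (hκ : ∀ s ∈ I, 0 < curvature α s) {s : ℝ} (hs : s ∈ I) :
    inner ℝ (tangent α s) (tangent α s) = (1 : ℝ) ∧
    inner ℝ (tangent α s) (normal α s) = (0 : ℝ) ∧
    inner ℝ (tangent α s) (binormal α s) = (0 : ℝ) ∧
    inner ℝ (normal α s) (tangent α s) = (0 : ℝ) ∧
    inner ℝ (normal α s) (normal α s) = (1 : ℝ) ∧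
    inner ℝ (normal α s) (binormal α s) = (0 : ℝ) ∧
    inner ℝ (binormal α s) (tangent α s) = (0 : ℝ) ∧
    inner ℝ (binormal α s) (normal α s) = (0 : ℝ) ∧
    inner ℝ (binormal α s) (binormal α s) = (1 : ℝ) := by
  obtain ⟨b, h0, h1, h2⟩ := hα.exists_frenetBasis hI hκ hs
  simp only [← h0, ← h1, ← h2, b.inner_eq_ite]
  simp

lemma IsArcLengthCurve.hasDerivAt_curvature (hα : IsArcLengthCurve α I) (hI : IsOpen I)
    (hκ : ∀ s ∈ I, 0 < curvature α s) {s : ℝ} (hs : s ∈ I) :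
    HasDerivAt (curvature α) (deriv (curvature α) s) s :=
  ContDiffOn.hasDerivAt_of_isOpen (hα.contDiffOn_curvature hI hκ) hI hs

lemma IsArcLengthCurve.map_normal (hα : IsArcLengthCurve α I) (hI : IsOpen I)
    (hκ : ∀ s ∈ I, 0 < curvature α s)
    (hL : ∀ s ∈ I, L (tangent α s) = curvature α s • binormal α s) {s : ℝ} (hs : s ∈ I) :
    L (normal α s) = -torsion α s • normal α s
      + (deriv (curvature α) s / curvature α s) • binormal α s := by
  have h := eq_of_hasDerivAt_of_eqOn hI hL hs
    (hasDerivAt_map L (hα.hasDerivAt_tangent hI hκ hs))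
    ((hα.hasDerivAt_curvature hI hκ hs).smul (hα.hasDerivAt_binormal hI hκ hs))
  have hne := (hκ s hs).ne'
  rw [map_smul] at h
  rw [← inv_smul_smul₀ hne (L (normal α s)), h, smul_add, smul_smul, smul_smul, smul_smul]
  congr 2 <;> field_simp

lemma IsArcLengthCurve.bigSigma_eq (hα : IsArcLengthCurve α I) (hI : IsOpen I)
    (hκ : ∀ s ∈ I, 0 < curvature α s)
    (hL : ∀ s ∈ I, L (tangent α s) = curvature α s • binormal α s) {s : ℝ} (hs : s ∈ I) :
    bigSigma α s = torsion α s * inner ℝ (binormal α s) (L (binormal α s)) := by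
  have key : ∀ r ∈ I, inner ℝ (binormal α r) (L (normal α r))
      = deriv (curvature α) r / curvature α r := by
    intro r hr
    obtain ⟨-, -, -, -, -, -, -, e1, e2⟩ := hα.frenet_inner hI hκ hr
    rw [hα.map_normal hI hκ hL hr, inner_add_right, inner_smul_right, inner_smul_right, e1, e2]
    ring
  have hd := (hα.hasDerivAt_binormal hI hκ hs).inner ℝ
    (hasDerivAt_map L (hα.hasDerivAt_normal hI hκ hs))
  have hd' := hd.congr_of_eventuallyEq (Filter.eventuallyEq_of_mem (hI.mem_nhds hs)
    fun r hr => (key r hr).symm)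
  obtain ⟨-, -, -, e1, e2, e3, e4, e5, e6⟩ := hα.frenet_inner hI hκ hs
  rw [bigSigma, hd'.deriv, map_add, map_smul, map_smul, hL s hs, hα.map_normal hI hκ hL hs]
  simp only [inner_add_right, inner_smul_right, inner_smul_left, e2, e3, e6]
  simp
  ring

lemma IsArcLengthCurve.map_binormal (hα : IsArcLengthCurve α I) (hI : IsOpen I)
    (hκ : ∀ s ∈ I, 0 < curvature α s) (hτ : ∀ s ∈ I, torsion α s ≠ 0)
    (hL : ∀ s ∈ I, L (tangent α s) = curvature α s • binormal α s) {s : ℝ} (hs : s ∈ I) :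
    L (binormal α s) = curvature α s • tangent α s
      + (deriv (curvature α) s / curvature α s) • normal α s
      + (inner ℝ (binormal α s) (L (binormal α s)) : ℝ) • binormal α s := by
  have k1 : ∀ r ∈ I, inner ℝ (tangent α r) (L (normal α r)) = (0 : ℝ) := by
    intro r hr
    obtain ⟨e1, e2, e3, -⟩ := hα.frenet_inner hI hκ hr
    rw [hα.map_normal hI hκ hL hr, inner_add_right, inner_smul_right, inner_smul_right, e2, e3]
    ring
  have k2 : ∀ r ∈ I, inner ℝ (tangent α r) (L (binormal α r)) = curvature α r := by
    intro r hr
    have h := eq_of_hasDerivAt_of_eqOn hI k1 hr ((hα.hasDerivAt_tangent hI hκ hr).inner ℝ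
      (hasDerivAt_map L (hα.hasDerivAt_normal hI hκ hr))) (hasDerivAt_const r (0 : ℝ))
    obtain ⟨e1, e2, e3, e4, e5, e6, -⟩ := hα.frenet_inner hI hκ hr
    rw [map_add, map_smul, map_smul, hL r hr, hα.map_normal hI hκ hL hr] at h
    simp only [inner_add_right, inner_smul_right, inner_smul_left, e3, e5, e6,
      conj_trivial] at h
    refine mul_left_cancel₀ (hτ r hr) ?_
    linarith
  have k3 : inner ℝ (normal α s) (L (binormal α s))
      = deriv (curvature α) s / curvature α s := by
    have h := eq_of_hasDerivAt_of_eqOn hI k2 hs ((hα.hasDerivAt_tangent hI hκ hs).inner ℝ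
      (hasDerivAt_map L (hα.hasDerivAt_binormal hI hκ hs))) (hα.hasDerivAt_curvature hI hκ hs)
    rw [map_smul, inner_smul_right, k1 s hs, inner_smul_left, conj_trivial] at h
    rw [eq_div_iff (hκ s hs).ne']
    linarith
  have := hα.frenet_expand hI hκ hs (L (binormal α s))
  rwa [k2 s hs, k3] at this

/-- The linear map is symmetric if the torsion does not vanish. -/
lemma IsArcLengthCurve.isSymmetric (hα : IsArcLengthCurve α I) (hI : IsOpen I)
    (hIne : I.Nonempty) (hκ : ∀ s ∈ I, 0 < curvature α s) (hτ : ∀ s ∈ I, torsion α s ≠ 0)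
    (hL : ∀ s ∈ I, L (tangent α s) = curvature α s • binormal α s) : L.IsSymmetric := by
  obtain ⟨s, hs⟩ := hIne
  obtain ⟨e1, e2, e3, e4, e5, e6, e7, e8, e9⟩ := hα.frenet_inner hI hκ hs
  intro x y
  rw [hα.frenet_expand hI hκ hs x, hα.frenet_expand hI hκ hs y]
  simp only [map_add, map_smul, hL s hs, hα.map_normal hI hκ hL hs]
  rw [hα.map_binormal hI hκ hτ hL hs]
  simp only [inner_add_left, inner_add_right, inner_smul_left, inner_smul_right, conj_trivial,
    e1, e2, e3, e4, e5, e6, e7, e8, e9]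
  ring

/-- The elementary symmetric functions of the eigenvalues of the linear map in terms of
curvature and torsion. -/
lemma IsArcLengthCurve.charpoly_coeffs (hα : IsArcLengthCurve α I) (hI : IsOpen I)
    (hκ : ∀ s ∈ I, 0 < curvature α s)
    (hL : ∀ s ∈ I, L (tangent α s) = curvature α s • binormal α s) (hsymm : L.IsSymmetric)
    {l₁ l₂ l₃ : ℝ} (hl : L.charpoly = (Polynomial.X - Polynomial.C l₁)
      * (Polynomial.X - Polynomial.C l₂) * (Polynomial.X - Polynomial.C l₃))
    {s : ℝ} (hs : s ∈ I) :
    l₁ * l₂ * l₃ = curvature α s ^ 2 * torsion α s ∧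
    l₁ + l₂ + l₃ = inner ℝ (binormal α s) (L (binormal α s)) - torsion α s ∧
    l₁ * l₂ + l₁ * l₃ + l₂ * l₃ = -curvature α s ^ 2
      - torsion α s * inner ℝ (binormal α s) (L (binormal α s))
      - (deriv (curvature α) s / curvature α s) ^ 2 := by
  obtain ⟨b, h0, h1, h2⟩ := hα.exists_frenetBasis hI hκ hs
  obtain ⟨e1, e2, e3, e4, e5, e6, e7, e8, e9⟩ := hα.frenet_inner hI hκ hs
  set μ : ℝ := inner ℝ (binormal α s) (L (binormal α s)) with hμ
  set ρ : ℝ := deriv (curvature α) s / curvature α s with hρ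
  have hLt := hL s hs
  have hLn := hα.map_normal hI hκ hL hs
  have f1 : inner ℝ (tangent α s) (L (binormal α s)) = curvature α s := by
    rw [← hsymm, hLt, inner_smul_left, e9]; simp
  have f2 : inner ℝ (normal α s) (L (binormal α s)) = ρ := by
    rw [← hsymm, hLn, inner_add_left, inner_smul_left, inner_smul_left, e6, e9]; simp [hρ]
  have n1 : ‖normal α s‖ = 1 := h1 ▸ b.norm_eq_one 1
  have n2 : ‖binormal α s‖ = 1 := h2 ▸ b.norm_eq_one 2
  have hmat : L.toMatrix b.toBasis b.toBasis =
      !![0, 0, curvature α s; 0, -torsion α s, ρ; curvature α s, ρ, μ] := by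
    ext i j
    rw [LinearMap.toMatrix_apply, OrthonormalBasis.coe_toBasis,
      OrthonormalBasis.coe_toBasis_repr_apply, OrthonormalBasis.repr_apply_apply]
    fin_cases i <;> fin_cases j <;>
      simp [h0, h1, h2, hLt, hLn, f1, f2, inner_add_right, inner_smul_right, e2, e3, e6, e8,
        n1, n2, ← hμ, ← hρ]
  have hev : ∀ x : ℝ, (x - l₁) * (x - l₂) * (x - l₃) =
      x * ((x + torsion α s) * (x - μ) - ρ ^ 2) - curvature α s ^ 2 * (x + torsion α s) := by
    intro x
    have := congrArg (Polynomial.eval x) hl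
    rw [← LinearMap.charpoly_toMatrix L b.toBasis, hmat, Matrix.charpoly,
      Matrix.det_fin_three] at this
    simp at this
    linarith
  have z0 := hev 0
  have z1 := hev 1
  have z2 := hev (-1)
  refine ⟨?_, ?_, ?_⟩ <;> linarith

end LinearRelation

/-! ### The linear relation between the generating curves of a minimal translation surface -/

section Minimal

variable {α β : ℝ → E3} {I J : Set ℝ}

lemma IsMinimalSurface.inner_eq_inner
    (hα : IsArcLengthCurve α I) (hβ : IsArcLengthCurve β J)
    (hmin : IsMinimalSurface (fun s t => α s + β t) I J)
    (hκα : ∀ s ∈ I, 0 < curvature α s) (hκβ : ∀ t ∈ J, 0 < curvature β t)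
    {s t : ℝ} (hs : s ∈ I) (ht : t ∈ J) :
    inner ℝ (curvature α s • binormal α s) (tangent β t)
      = (inner ℝ (tangent α s) (curvature β t • binormal β t) : ℝ) := by
  have d1 : ∀ u v, dS (fun s t => α s + β t) u v = tangent α u := fun u v => by
    simp [dS, tangent]
  have d2 : ∀ u v, dT (fun s t => α s + β t) u v = tangent β v := fun u v => by
    simp [dT, tangent]
  have hd1 : dS (fun s t => α s + β t) = fun u _ => tangent α u := by ext1 u; ext1 v; exact d1 u v
  have hd2 : dT (fun s t => α s + β t) = fun _ v => tangent β v := by ext1 u; ext1 v; exact d2 u v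
  have hreg := hmin.regular s hs t ht
  have hH := hmin.meanCurvature_eq_zero s hs t ht
  rw [d1, d2] at hreg
  have d11 : dS (dS (fun s t => α s + β t)) s t = curvature α s • normal α s := by
    rw [hd1, dS, deriv_tangent_eq (hκα s hs)]
  have d12 : dT (dS (fun s t => α s + β t)) s t = 0 := by
    rw [hd1, dT, deriv_const]
  have d22 : dT (dT (fun s t => α s + β t)) s t = curvature β t • normal β t := by
    rw [hd2, dT, deriv_tangent_eq (hκβ t ht)]
  have hEG : (1 : ℝ) - inner ℝ (tangent α s) (tangent β t) ^ 2 ≠ 0 := by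
    have h := inner_cross_cross (tangent α s) (tangent β t)
    rw [hα.inner_tangent_self hs, hβ.inner_tangent_self ht, one_mul] at h
    rw [← h]
    exact inner_self_ne_zero.2 hreg
  simp only [meanCurvature, gaussNormal, d1, d2, d11, d12, d22, hα.inner_tangent_self hs,
    hβ.inner_tangent_self ht, inner_zero_right, mul_one] at hH
  rw [div_eq_zero_iff, or_iff_left (mul_ne_zero two_ne_zero hEG), inner_smul_left,
    inner_smul_left, conj_trivial, mul_zero, zero_mul, sub_zero, ← mul_add,
    mul_eq_zero, or_iff_right (inv_ne_zero (norm_ne_zero_iff.2 hreg)),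
    inner_smul_right, inner_smul_right] at hH
  rw [inner_smul_left, inner_smul_right, conj_trivial]
  simp only [binormal]
  simp only [inner_eq, cross_zero, cross_one, cross_two] at hH ⊢
  linarith

/-- There is a linear map carrying the tangent vectors of each of the generating curves to
`t × t'`, up to passing to the adjoint. -/
lemma IsMinimalSurface.exists_linearMap (hI : IsOpen I) (hJ : IsOpen J)
    (hIne : I.Nonempty) (hJne : J.Nonempty)
    (hα : IsArcLengthCurve α I) (hβ : IsArcLengthCurve β J)
    (hmin : IsMinimalSurface (fun s t => α s + β t) I J)
    (hκα : ∀ s ∈ I, 0 < curvature α s) (hκβ : ∀ t ∈ J, 0 < curvature β t)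
    (hτα : ∀ s ∈ I, torsion α s ≠ 0) (hτβ : ∀ t ∈ J, torsion β t ≠ 0) :
    ∃ L : E3 →ₗ[ℝ] E3,
      (∀ s ∈ I, L (tangent α s) = curvature α s • binormal α s) ∧
      (∀ t ∈ J, L.adjoint (tangent β t) = curvature β t • binormal β t) := by
  have key := fun s hs t ht => hmin.inner_eq_inner hα hβ hκα hκβ (s := s) (t := t) hs ht
  have hspβ := hβ.span_tangent hJ hJne hκβ hτβ
  have hspα := hα.span_tangent hI hIne hκα hτα
  set b := Module.Basis.ofSpan hspβ.ge
  have hb : ∀ i, ∃ t ∈ J, tangent β t = b i := fun i =>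
    Module.Basis.ofSpan_subset hspβ.ge ⟨i, rfl⟩
  choose τ hτJ hτb using hb
  set N : E3 →ₗ[ℝ] E3 := b.constr ℝ fun i => curvature β (τ i) • binormal β (τ i)
  have hNα : ∀ s ∈ I, N.adjoint (tangent α s) = curvature α s • binormal α s := by
    intro s hs
    refine InnerProductSpace.ext_inner_right_basis b fun i => ?_
    rw [LinearMap.adjoint_inner_left, Module.Basis.constr_basis, ← key s hs _ (hτJ i), hτb]
  refine ⟨N.adjoint, hNα, fun t ht => ?_⟩
  rw [LinearMap.adjoint_adjoint]
  rw [← sub_eq_zero, ← Submodule.mem_bot ℝ, ← Submodule.top_orthogonal_eq_bot, ← hspα,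
    Submodule.mem_orthogonal]
  intro u hu
  induction hu using Submodule.span_induction with
  | mem u hu =>
    obtain ⟨s, hs, rfl⟩ := hu
    rw [inner_sub_right, ← key s hs t ht, ← hNα s hs, LinearMap.adjoint_inner_left, sub_self]
  | zero => simp
  | add u v _ _ hu hv => rw [inner_add_left, hu, hv, add_zero]
  | smul a u _ hu => rw [inner_smul_left, hu, mul_zero]

end Minimal

/-! ### The autonomous equation for the angle function -/

section Angle

lemma eq_of_hasDerivAt_zero {F : Type*} [NormedAddCommGroup F] [NormedSpace ℝ F] {f : ℝ → F}
    {J : Set ℝ} (hJ : IsOpen J) (hJ' : J.OrdConnected) (hf : ∀ t ∈ J, HasDerivAt f 0 t)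
    {s t : ℝ} (hs : s ∈ J) (ht : t ∈ J) : f s = f t :=
  hJ.is_const_of_deriv_eq_zero hJ'.isPreconnected
    (fun r hr => (hf r hr).differentiableAt.differentiableWithinAt)
    (fun r hr => (hf r hr).deriv) hs ht

/-- The third coordinate of the tangent vector of the model curve. -/
def height (A B w : ℝ) : ℝ := √(1 - A ^ 2 * Real.cos w ^ 2 - B ^ 2 * Real.sin w ^ 2)

variable {A B k : ℝ}

lemma radicand_pos (hA : 0 < A) (hA' : A < 1) (hB : 0 < B) (hB' : B < 1) (w : ℝ) :
    0 < 1 - A ^ 2 * Real.cos w ^ 2 - B ^ 2 * Real.sin w ^ 2 := by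
  have hA2 : 0 < 1 - A ^ 2 := by nlinarith
  have hB2 : 0 < 1 - B ^ 2 := by nlinarith
  have h := Real.sin_sq_add_cos_sq w
  have h' : 1 - A ^ 2 * Real.cos w ^ 2 - B ^ 2 * Real.sin w ^ 2
      = (1 - A ^ 2) * Real.cos w ^ 2 + (1 - B ^ 2) * Real.sin w ^ 2 := by linarith
  rw [h']
  rcases (sq_nonneg (Real.cos w)).eq_or_lt with h0 | h0
  · rw [← h0] at h ⊢
    rw [add_zero] at h
    rw [h]; linarith
  · have := mul_nonneg hB2.le (sq_nonneg (Real.sin w))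
    have := mul_pos hA2 h0
    linarith

lemma height_pos (hA : 0 < A) (hA' : A < 1) (hB : 0 < B) (hB' : B < 1) (w : ℝ) :
    0 < height A B w := Real.sqrt_pos.2 (radicand_pos hA hA' hB hB' w)

lemma height_sq (hA : 0 < A) (hA' : A < 1) (hB : 0 < B) (hB' : B < 1) (w : ℝ) :
    height A B w ^ 2 = 1 - A ^ 2 * Real.cos w ^ 2 - B ^ 2 * Real.sin w ^ 2 :=
  Real.sq_sqrt (radicand_pos hA hA' hB hB' w).le

lemma height_le_one (w : ℝ) : height A B w ≤ 1 := by
  refine Real.sqrt_le_one.2 ?_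
  nlinarith [sq_nonneg (A * Real.cos w), sq_nonneg (B * Real.sin w)]

lemma contDiff_height (hA : 0 < A) (hA' : A < 1) (hB : 0 < B) (hB' : B < 1) :
    ContDiff ℝ ∞ (height A B) := by
  unfold height
  refine ContDiff.sqrt ?_ fun w => (radicand_pos hA hA' hB hB' w).ne'
  exact (contDiff_const.sub (contDiff_const.mul (Real.contDiff_cos.pow 2))).sub
    (contDiff_const.mul (Real.contDiff_sin.pow 2))

lemma hasDerivAt_height (hA : 0 < A) (hA' : A < 1) (hB : 0 < B) (hB' : B < 1) (w : ℝ) :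
    HasDerivAt (height A B)
      ((A ^ 2 - B ^ 2) * Real.cos w * Real.sin w / height A B w) w := by
  have h := (((((Real.hasDerivAt_cos w).pow 2).const_mul (A ^ 2)).const_sub 1).sub
    (((Real.hasDerivAt_sin w).pow 2).const_mul (B ^ 2))).sqrt (radicand_pos hA hA' hB hB' w).ne'
  refine h.congr_deriv ?_
  have := (height_pos hA hA' hB hB' w).ne'
  change _ / (2 * height A B w) = _
  field_simp
  ring

/-- A function whose derivative is a smooth function of its value is smooth. -/
lemma contDiff_of_hasDerivAt_comp {W g : ℝ → ℝ} (hg : ContDiff ℝ ∞ g)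
    (hW : ∀ u, HasDerivAt W (g (W u)) u) : ContDiff ℝ ∞ W := by
  rw [contDiff_infty]
  intro n
  induction n with
  | zero =>
    exact contDiff_zero.2 (continuous_iff_continuousAt.2 fun u => (hW u).continuousAt)
  | succ n ih =>
    have hd : deriv W = g ∘ W := funext fun u => (hW u).deriv
    push_cast
    rw [contDiff_succ_iff_deriv]
    refine ⟨fun u => (hW u).differentiableAt, by simp, ?_⟩
    rw [hd]
    exact (contDiff_infty.1 hg n).comp ih

/-- The global solution of `W' = k · height W`, as the inverse of an antiderivative. -/
lemma exists_angle (hA : 0 < A) (hA' : A < 1) (hB : 0 < B) (hB' : B < 1) (hk : 0 < k) :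
    ∃ W G : ℝ → ℝ, ContDiff ℝ ∞ W ∧ (∀ u, HasDerivAt W (k * height A B (W u)) u) ∧
      (∀ w, W (G w) = w) ∧ (∀ w, HasDerivAt G (k * height A B w)⁻¹ w) := by
  have hpos : ∀ w, 0 < k * height A B w := fun w => mul_pos hk (height_pos hA hA' hB hB' w)
  have hcont : Continuous fun w => (k * height A B w)⁻¹ :=
    (continuous_const.mul (contDiff_height hA hA' hB hB').continuous).inv₀ fun w => (hpos w).ne'
  set G : ℝ → ℝ := fun w => ∫ v in (0 : ℝ)..w, (k * height A B v)⁻¹ with hG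
  have hGd : ∀ w, HasDerivAt G (k * height A B w)⁻¹ w := fun w =>
    hcont.integral_hasStrictDerivAt 0 w |>.hasDerivAt
  have hle : ∀ w, k⁻¹ ≤ (k * height A B w)⁻¹ := fun w =>
    inv_anti₀ (hpos w) (mul_le_of_le_one_right hk.le (height_le_one w))
  have hmono : StrictMono G := strictMono_of_deriv_pos fun w => by
    rw [(hGd w).deriv]; exact inv_pos.2 (hpos w)
  have hcG : Continuous G := continuous_iff_continuousAt.2 fun w => (hGd w).continuousAt
  have hG0 : G 0 = 0 := by simp [hG]
  have hmono' : Monotone fun w => G w - k⁻¹ * w := by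
    have hd : ∀ w, HasDerivAt (fun w => G w - k⁻¹ * w) ((k * height A B w)⁻¹ - k⁻¹ * 1) w :=
      fun w => (hGd w).sub ((hasDerivAt_id w).const_mul k⁻¹)
    refine monotone_of_deriv_nonneg (fun w => (hd w).differentiableAt) fun w => ?_
    rw [(hd w).deriv, mul_one]
    exact sub_nonneg.2 (hle w)
  have hki : 0 < k⁻¹ := inv_pos.2 hk
  have hsurj : Function.Surjective G := by
    refine hcG.surjective ?_ ?_
    · refine Filter.tendsto_atTop_mono' _ ?_ (Filter.tendsto_id.const_mul_atTop hki)
      filter_upwards [Filter.eventually_ge_atTop 0] with w hw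
      have := hmono' hw
      simp only [hG0, mul_zero, sub_zero] at this
      simp only [id]
      linarith
    · refine Filter.tendsto_atBot_mono' _ ?_ (Filter.tendsto_id.const_mul_atBot hki)
      filter_upwards [Filter.eventually_le_atBot 0] with w hw
      have := hmono' hw
      simp only [hG0, mul_zero, sub_zero] at this
      simp only [id]
      linarith
  set e := hmono.orderIsoOfSurjective G hsurj
  have heG : ∀ w, e.symm (G w) = w := fun w => e.symm_apply_apply w
  have hGe : ∀ u, G (e.symm u) = u := fun u => e.apply_symm_apply u
  have hd : ∀ u, HasDerivAt e.symm (k * height A B (e.symm u)) u := fun u => by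
    have := HasDerivAt.of_local_left_inverse (f := G) (g := e.symm) (a := u)
      e.symm.continuous.continuousAt (hGd (e.symm u)) (inv_ne_zero (hpos _).ne')
      (Filter.Eventually.of_forall hGe)
    rwa [inv_inv] at this
  exact ⟨e.symm, G, contDiff_of_hasDerivAt_comp
    (contDiff_const.mul (contDiff_height hA hA' hB hB')) hd, hd, heG, hGd⟩

lemma exists_cos_sin {p q : ℝ} (h : p ^ 2 + q ^ 2 = 1) :
    ∃ θ : ℝ, Real.cos θ = p ∧ Real.sin θ = q := by
  have hn : ‖(⟨p, q⟩ : ℂ)‖ = 1 := by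
    rw [Complex.norm_eq_sqrt_sq_add_sq, h, Real.sqrt_one]
  have h0 : (⟨p, q⟩ : ℂ) ≠ 0 := norm_ne_zero_iff.1 (by rw [hn]; exact one_ne_zero)
  refine ⟨Complex.arg ⟨p, q⟩, ?_, ?_⟩
  · rw [Complex.cos_arg h0, hn, div_one]
  · rw [Complex.sin_arg, hn, div_one]

lemma hasDerivAt_integral_of_continuousOn {f : ℝ → ℝ} {J : Set ℝ} (hJ : IsOpen J)
    (hJ' : J.OrdConnected) (hf : ContinuousOn f J) {a t : ℝ} (ha : a ∈ J) (ht : t ∈ J) :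
    HasDerivAt (fun u => ∫ r in a..u, f r) (f t) t :=
  intervalIntegral.integral_hasDerivAt_right
    ((hf.mono (hJ'.uIcc_subset ha ht)).intervalIntegrable)
    (hf.stronglyMeasurableAtFilter hJ t ht) (hf.continuousAt (hJ.mem_nhds ht))

/-- Solutions of the equations for the coordinates of the tangent vector are given by the angle
function. -/
lemma exists_shift_of_system (hA : 0 < A) (hA' : A < 1) (hB : 0 < B) (hB' : B < 1) (hk : 0 < k)
    {W G : ℝ → ℝ} (hWG : ∀ w, W (G w) = w) (hG : ∀ w, HasDerivAt G (k * height A B w)⁻¹ w)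
    {J : Set ℝ} (hJ : IsOpen J) (hJ' : J.OrdConnected) (hJne : J.Nonempty)
    {ε : ℝ} (hε : ε = 1 ∨ ε = -1) {x y z : ℝ → ℝ} (hzc : ContinuousOn z J)
    (hx : ∀ t ∈ J, HasDerivAt x (-(A / B * k) * (y t * z t)) t)
    (hy : ∀ t ∈ J, HasDerivAt y (B / A * k * (x t * z t)) t)
    (hz : ∀ t ∈ J, 0 < ε * z t)
    (hquad : ∀ t ∈ J, (x t / A) ^ 2 + (y t / B) ^ 2 = 1)
    (hsph : ∀ t ∈ J, x t ^ 2 + y t ^ 2 + z t ^ 2 = 1) :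
    ∃ c : ℝ, ∀ t ∈ J, x t = ε * (A * Real.cos (W (ε * t + c))) ∧
      y t = ε * (B * Real.sin (W (ε * t + c))) ∧ z t = ε * height A B (W (ε * t + c)) := by
  obtain ⟨a, ha⟩ := hJne
  have hε2 : ε * ε = 1 := by rcases hε with rfl | rfl <;> norm_num
  have hε0 : ε ≠ 0 := by rintro rfl; simp at hε2
  obtain ⟨θ, hc, hs⟩ := exists_cos_sin (p := ε * (x a / A)) (q := ε * (y a / B)) (by
    rw [← hquad a ha]; linear_combination ((x a / A) ^ 2 + (y a / B) ^ 2) * hε2)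
  set f : ℝ → ℝ := fun t => θ + ∫ r in a..t, k * z r with hf
  have hfd : ∀ t ∈ J, HasDerivAt f (k * z t) t := fun t ht =>
    (hasDerivAt_integral_of_continuousOn hJ hJ' (continuousOn_const.mul hzc) ha ht).const_add θ
  have hfa : f a = θ := by simp [hf]
  have hp : ∀ t ∈ J, x t / A * Real.cos (f t) + y t / B * Real.sin (f t) = ε := by
    intro t ht
    have h := eq_of_hasDerivAt_zero hJ hJ'
      (f := fun t => x t / A * Real.cos (f t) + y t / B * Real.sin (f t)) (fun t ht => by
        refine ((((hx t ht).div_const A).mul (hfd t ht).cos).add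
          (((hy t ht).div_const B).mul (hfd t ht).sin)).congr_deriv ?_
        field_simp
        ring) ht ha
    rw [h, hfa, hc, hs]
    linear_combination ε * hquad a ha
  have hq : ∀ t ∈ J, y t / B * Real.cos (f t) - x t / A * Real.sin (f t) = 0 := by
    intro t ht
    have h := eq_of_hasDerivAt_zero hJ hJ'
      (f := fun t => y t / B * Real.cos (f t) - x t / A * Real.sin (f t)) (fun t ht => by
        refine ((((hy t ht).div_const B).mul (hfd t ht).cos).sub
          (((hx t ht).div_const A).mul (hfd t ht).sin)).congr_deriv ?_
        field_simp
        ring) ht ha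
    rw [h, hfa, hc, hs]
    ring
  have hX : ∀ t ∈ J, x t = ε * (A * Real.cos (f t)) := by
    intro t ht
    have h1 : x t / A = ε * Real.cos (f t) := by
      linear_combination Real.cos (f t) * hp t ht - Real.sin (f t) * hq t ht
        - x t / A * Real.sin_sq_add_cos_sq (f t)
    rw [div_eq_iff hA.ne'] at h1
    rw [h1]; ring
  have hY : ∀ t ∈ J, y t = ε * (B * Real.sin (f t)) := by
    intro t ht
    have h1 : y t / B = ε * Real.sin (f t) := by
      linear_combination Real.sin (f t) * hp t ht + Real.cos (f t) * hq t ht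
        - y t / B * Real.sin_sq_add_cos_sq (f t)
    rw [div_eq_iff hB.ne'] at h1
    rw [h1]; ring
  have hZ : ∀ t ∈ J, z t = ε * height A B (f t) := by
    intro t ht
    have h1 : (ε * z t) ^ 2 = height A B (f t) ^ 2 := by
      rw [height_sq hA hA' hB hB']
      have h2 := hsph t ht
      rw [hX t ht, hY t ht] at h2
      linear_combination h2 + (z t ^ 2 - A ^ 2 * Real.cos (f t) ^ 2
        - B ^ 2 * Real.sin (f t) ^ 2) * hε2
    have h3 := (pow_left_inj₀ (hz t ht).le (height_pos hA hA' hB hB' (f t)).le two_ne_zero).1 h1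
    rw [← h3, ← mul_assoc, hε2, one_mul]
  have hGf : ∀ t ∈ J, HasDerivAt (fun t => G (f t) - ε * t) 0 t := by
    intro t ht
    refine (((hG (f t)).comp t (hfd t ht)).sub
      ((hasDerivAt_id t).const_mul ε)).congr_deriv ?_
    have := (height_pos hA hA' hB hB' (f t)).ne'
    rw [hZ t ht]
    field_simp
    ring
  refine ⟨G (f a) - ε * a, fun t ht => ?_⟩
  have h := eq_of_hasDerivAt_zero hJ hJ' hGf ht ha
  have hW : W (ε * t + (G (f a) - ε * a)) = f t := by
    rw [← h, add_sub_cancel, hWG]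
  rw [hW]
  exact ⟨hX t ht, hY t ht, hZ t ht⟩

end Angle

/-! ### Isometries adapted to a symmetric linear map -/

section Adapted

/-- The isometry changing the signs of the coordinates. -/
lemma exists_signs {a b c : ℝ} (ha : a = 1 ∨ a = -1) (hb : b = 1 ∨ b = -1)
    (hc : c = 1 ∨ c = -1) :
    ∃ D : E3 ≃ₗᵢ[ℝ] E3, (∀ x, D x = !₂[a * x 0, b * x 1, c * x 2]) ∧
      LinearMap.det (D.toLinearEquiv : E3 →ₗ[ℝ] E3) = a * b * c := by
  have ha' : a * a = 1 := by rcases ha with rfl | rfl <;> norm_num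
  have hb' : b * b = 1 := by rcases hb with rfl | rfl <;> norm_num
  have hc' : c * c = 1 := by rcases hc with rfl | rfl <;> norm_num
  let f : E3 →ₗ[ℝ] E3 :=
    { toFun := fun x => !₂[a * x 0, b * x 1, c * x 2]
      map_add' := fun x y => by apply ext3 <;> simp <;> ring
      map_smul' := fun r x => by apply ext3 <;> simp <;> ring }
  have hf : ∀ x, f x = !₂[a * x 0, b * x 1, c * x 2] := fun x => rfl
  have hinv : Function.Involutive f := fun x => by
    apply ext3 <;> simp [hf, ← mul_assoc, ha', hb', hc']
  let D : E3 ≃ₗᵢ[ℝ] E3 := (LinearEquiv.ofInvolutive f hinv).isometryOfInner fun x y => by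
    simp only [LinearEquiv.coe_ofInvolutive, hf, inner_eq]
    simp
    linear_combination x 0 * y 0 * ha' + x 1 * y 1 * hb' + x 2 * y 2 * hc'
  refine ⟨D, fun x => rfl, ?_⟩
  have hD : (D.toLinearEquiv : E3 →ₗ[ℝ] E3) = f := rfl
  rw [hD, ← LinearMap.det_toMatrix (EuclideanSpace.basisFun (Fin 3) ℝ).toBasis,
    Matrix.det_fin_three]
  simp [LinearMap.toMatrix_apply, hf]

lemma det_isometry (M : E3 ≃ₗᵢ[ℝ] E3) :
    LinearMap.det (M.toLinearEquiv : E3 →ₗ[ℝ] E3) = 1 ∨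
      LinearMap.det (M.toLinearEquiv : E3 →ₗ[ℝ] E3) = -1 := by
  have h := map_cross M !₂[1, 0, 0] !₂[0, 1, 0]
  have h2 := congrArg (fun v : E3 => (inner ℝ v v : ℝ)) h
  simp only [inner_cross_cross, inner_smul_left, inner_smul_right, M.inner_map_map,
    conj_trivial] at h2
  simp only [inner_eq] at h2
  simp at h2
  exact mul_self_eq_one_iff.1 h2.symm

/-- The isometry `M` carries the linear map `L` to a diagonal map, and its determinant is `σ`. -/
structure IsAdapted (L : E3 →ₗ[ℝ] E3) (l₁ l₂ l₃ σ : ℝ) (M : E3 ≃ₗᵢ[ℝ] E3) : Prop where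
  zero : ∀ x, M (L x) 0 = l₁ * M x 0
  one : ∀ x, M (L x) 1 = l₂ * M x 1
  two : ∀ x, M (L x) 2 = l₃ * M x 2
  det : LinearMap.det (M.toLinearEquiv : E3 →ₗ[ℝ] E3) = σ

/-- The signs and the order of the eigenvalues. -/
structure IsOrdered (l₁ l₂ l₃ σ : ℝ) : Prop where
  sign : σ = 1 ∨ σ = -1
  le : σ * l₁ ≤ σ * l₂
  neg : σ * l₂ < 0
  pos : 0 < σ * l₃

lemma det_trans (M D : E3 ≃ₗᵢ[ℝ] E3) :
    LinearMap.det ((M.trans D).toLinearEquiv : E3 →ₗ[ℝ] E3)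
      = LinearMap.det (D.toLinearEquiv : E3 →ₗ[ℝ] E3)
        * LinearMap.det (M.toLinearEquiv : E3 →ₗ[ℝ] E3) := by
  rw [← LinearMap.det_comp]
  rfl

variable {L : E3 →ₗ[ℝ] E3} {l₁ l₂ l₃ σ : ℝ} {M : E3 ≃ₗᵢ[ℝ] E3}

lemma IsAdapted.trans_signs (hM : IsAdapted L l₁ l₂ l₃ σ M) {a b c : ℝ} {D : E3 ≃ₗᵢ[ℝ] E3}
    (hD : ∀ x, D x = !₂[a * x 0, b * x 1, c * x 2])
    (hdet : LinearMap.det (D.toLinearEquiv : E3 →ₗ[ℝ] E3) = a * b * c) :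
    IsAdapted L l₁ l₂ l₃ (a * b * c * σ) (M.trans D) where
  zero x := by simp [hD, hM.zero]; ring
  one x := by simp [hD, hM.one]; ring
  two x := by simp [hD, hM.two]; ring
  det := by rw [det_trans, hdet, hM.det]

lemma IsOrdered.mul_self (h : IsOrdered l₁ l₂ l₃ σ) : σ * σ = 1 := by
  rcases h.sign with rfl | rfl <;> norm_num

lemma isAdapted_of_basis (hsymm : L.IsSymmetric) (b : OrthonormalBasis (Fin 3) ℝ E3)
    {ν : Fin 3 → ℝ} (hb : ∀ i, L (b i) = ν i • b i) :
    IsAdapted L (ν 0) (ν 1) (ν 2)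
      (LinearMap.det (b.repr.toLinearEquiv : E3 →ₗ[ℝ] E3)) b.repr := by
  have h : ∀ x i, b.repr (L x) i = ν i * b.repr x i := fun x i => by
    rw [b.repr_apply_apply, b.repr_apply_apply, ← hsymm, hb, inner_smul_left, conj_trivial]
  exact ⟨fun x => h x 0, fun x => h x 1, fun x => h x 2, rfl⟩

/-- An isotropic unit vector of a nondegenerate symmetric map forces eigenvalues of both signs. -/
lemma exists_isOrdered_isAdapted (hsymm : L.IsSymmetric) {x : E3} (hx : inner ℝ x x = (1 : ℝ))
    (hLx : inner ℝ x (L x) = (0 : ℝ))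
    (hdet : ∀ l₁ l₂ l₃ : ℝ, L.charpoly = (Polynomial.X - Polynomial.C l₁)
      * (Polynomial.X - Polynomial.C l₂) * (Polynomial.X - Polynomial.C l₃) →
      l₁ * l₂ * l₃ ≠ 0) :
    ∃ (l₁ l₂ l₃ σ δ : ℝ) (M : E3 ≃ₗᵢ[ℝ] E3), L.charpoly = (Polynomial.X - Polynomial.C l₁)
      * (Polynomial.X - Polynomial.C l₂) * (Polynomial.X - Polynomial.C l₃) ∧
      IsOrdered l₁ l₂ l₃ σ ∧ IsAdapted L l₁ l₂ l₃ δ M := by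
  have hn : Module.finrank ℝ E3 = 3 := by simp
  set ν := hsymm.eigenvalues hn
  set b := hsymm.eigenvectorBasis hn
  have hb : ∀ i, L (b i) = ν i • b i := hsymm.apply_eigenvectorBasis hn
  have hanti : Antitone ν := hsymm.eigenvalues_antitone hn
  have h01 : ν 1 ≤ ν 0 := hanti (by decide)
  have h12 : ν 2 ≤ ν 1 := hanti (by decide)
  have hchar : L.charpoly = (Polynomial.X - Polynomial.C (ν 0))
      * (Polynomial.X - Polynomial.C (ν 1)) * (Polynomial.X - Polynomial.C (ν 2)) := by
    rw [hsymm.charpoly_eq hn, Fin.prod_univ_three]; rfl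
  have hne := hdet _ _ _ hchar
  have hM := isAdapted_of_basis hsymm b hb
  rw [← b.repr.inner_map_map, inner_eq] at hx hLx
  rw [hM.zero, hM.one, hM.two] at hLx
  set p := b.repr x 0
  set q := b.repr x 1
  set r := b.repr x 2
  have h1 : ν 1 ≠ 0 := fun h => hne (by rw [h]; ring)
  have h0 : ν 0 ≠ 0 := fun h => hne (by rw [h]; ring)
  have h2 : ν 2 ≠ 0 := fun h => hne (by rw [h]; ring)
  rcases h1.lt_or_gt with h1 | h1
  · have hpos : 0 < ν 0 := by
      by_contra! hle
      have hlt := hle.lt_of_ne h0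
      nlinarith [mul_self_nonneg p, mul_self_nonneg q, mul_self_nonneg r]
    have hb' : ∀ i, L (b.reindex Fin.revPerm i) = ν (Fin.rev i) • b.reindex Fin.revPerm i :=
      fun i => by simp [hb]
    refine ⟨ν 2, ν 1, ν 0, 1, _, _, ?_, ⟨Or.inl rfl, ?_, ?_, ?_⟩,
      isAdapted_of_basis hsymm (b.reindex Fin.revPerm) hb'⟩
    · rw [hchar]; ring
    all_goals linarith
  · have hneg : ν 2 < 0 := by
      by_contra! hle
      have hlt := hle.lt_of_ne' h2
      nlinarith [mul_self_nonneg p, mul_self_nonneg q, mul_self_nonneg r]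
    refine ⟨ν 0, ν 1, ν 2, -1, _, _, hchar, ⟨Or.inr rfl, ?_, ?_, ?_⟩, hM⟩
    all_goals linarith

end Adapted

/-! ### The coordinates of the tangent vectors -/

section Coordinates

variable {α : ℝ → E3} {I : Set ℝ} {L : E3 →ₗ[ℝ] E3} {l₁ l₂ l₃ σ δ : ℝ} {M : E3 ≃ₗᵢ[ℝ] E3}

lemma hasDerivAt_coord (M : E3 ≃ₗᵢ[ℝ] E3) {u : ℝ → E3} {u' : E3} {s : ℝ}
    (hu : HasDerivAt u u' s) (i : Fin 3) : HasDerivAt (fun r => M (u r) i) (M u' i) s := by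
  have h := hasDerivAt_map (M.toLinearEquiv : E3 →ₗ[ℝ] E3) hu
  exact (EuclideanSpace.proj (𝕜 := ℝ) i).hasFDerivAt.comp_hasDerivAt s h

lemma IsArcLengthCurve.coord_sphere (hα : IsArcLengthCurve α I) (M : E3 ≃ₗᵢ[ℝ] E3) {s : ℝ}
    (hs : s ∈ I) :
    M (tangent α s) 0 ^ 2 + M (tangent α s) 1 ^ 2 + M (tangent α s) 2 ^ 2 = 1 := by
  rw [← hα.inner_tangent_self hs, ← M.inner_map_map, inner_eq]
  ring

lemma coord_quadric (hM : IsAdapted L l₁ l₂ l₃ δ M)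
    (hL : ∀ s ∈ I, L (tangent α s) = curvature α s • binormal α s) {s : ℝ} (hs : s ∈ I) :
    l₁ * M (tangent α s) 0 ^ 2 + l₂ * M (tangent α s) 1 ^ 2 + l₃ * M (tangent α s) 2 ^ 2 = 0 := by
  have h : inner ℝ (tangent α s) (L (tangent α s)) = (0 : ℝ) := by
    rw [hL s hs, inner_smul_right, binormal, inner_cross_left, mul_zero]
  rw [← M.inner_map_map, inner_eq, hM.zero, hM.one, hM.two] at h
  linear_combination h

lemma IsOrdered.coord_two_ne_zero (hl : IsOrdered l₁ l₂ l₃ σ) {p q r : ℝ}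
    (h : l₁ * p ^ 2 + l₂ * q ^ 2 + l₃ * r ^ 2 = 0) (h1 : p ^ 2 + q ^ 2 + r ^ 2 = 1) : r ≠ 0 := by
  rintro rfl
  have := hl.le
  have := hl.neg
  have h' : σ * l₁ * p ^ 2 + σ * l₂ * q ^ 2 = 0 := by linear_combination σ * h
  nlinarith [sq_nonneg p, sq_nonneg q]

lemma IsArcLengthCurve.continuousOn_coord (hα : IsArcLengthCurve α I) (hI : IsOpen I)
    (M : E3 ≃ₗᵢ[ℝ] E3) (i : Fin 3) : ContinuousOn (fun s => M (tangent α s) i) I := fun _ hs =>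
  (hasDerivAt_coord M (ContDiffOn.hasDerivAt_of_isOpen (hα.contDiffOn_tangent hI) hI hs)
    i).continuousAt.continuousWithinAt

lemma IsArcLengthCurve.exists_sign (hα : IsArcLengthCurve α I) (hI : IsOpen I)
    (hI' : I.OrdConnected) (hl : IsOrdered l₁ l₂ l₃ σ) (hM : IsAdapted L l₁ l₂ l₃ δ M)
    (hL : ∀ s ∈ I, L (tangent α s) = curvature α s • binormal α s) :
    ∃ ε : ℝ, (ε = 1 ∨ ε = -1) ∧ ∀ s ∈ I, 0 < ε * M (tangent α s) 2 := by
  have hne : ∀ s ∈ I, M (tangent α s) 2 ≠ 0 := fun s hs =>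
    hl.coord_two_ne_zero (coord_quadric hM hL hs) (hα.coord_sphere M hs)
  have himg := hI'.isPreconnected.image _ (hα.continuousOn_coord hI M 2)
  by_cases hpos : ∀ s ∈ I, 0 < M (tangent α s) 2
  · exact ⟨1, Or.inl rfl, fun s hs => by simpa using hpos s hs⟩
  · push Not at hpos
    obtain ⟨a, ha, hle⟩ := hpos
    refine ⟨-1, Or.inr rfl, fun s hs => ?_⟩
    by_contra! hs'
    obtain ⟨r, hr, h0⟩ := himg.ordConnected.out ⟨a, ha, rfl⟩ ⟨s, hs, rfl⟩
      (show (0 : ℝ) ∈ _ from ⟨hle, by linarith⟩)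
    exact hne r hr h0

/-- After a change of signs, the isometry has prescribed determinant, and the third coordinate of
the tangent vectors is positive. -/
lemma IsArcLengthCurve.exists_isAdapted_pos (hα : IsArcLengthCurve α I) (hI : IsOpen I)
    (hI' : I.OrdConnected) (hl : IsOrdered l₁ l₂ l₃ σ) (hM : IsAdapted L l₁ l₂ l₃ δ M)
    (hL : ∀ s ∈ I, L (tangent α s) = curvature α s • binormal α s) :
    ∃ M' : E3 ≃ₗᵢ[ℝ] E3, IsAdapted L l₁ l₂ l₃ σ M' ∧ ∀ s ∈ I, 0 < M' (tangent α s) 2 := by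
  obtain ⟨ε, hε, hpos⟩ := hα.exists_sign hI hI' hl hM hL
  have hδ : δ = 1 ∨ δ = -1 := hM.det ▸ det_isometry M
  have hsign : σ * ε * δ = 1 ∨ σ * ε * δ = -1 := by
    rcases hl.sign with h1 | h1 <;> rcases hε with h2 | h2 <;> rcases hδ with h3 | h3 <;>
      rw [h1, h2, h3] <;> norm_num
  obtain ⟨D, hD, hDdet⟩ := exists_signs hsign (Or.inl rfl) hε
  refine ⟨M.trans D, ?_, fun s hs => ?_⟩
  · have := hM.trans_signs hD hDdet
    have hε2 : ε * ε = 1 := by rcases hε with h | h <;> rw [h] <;> norm_num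
    have hδ2 : δ * δ = 1 := by rcases hδ with h | h <;> rw [h] <;> norm_num
    convert this using 1
    linear_combination (-σ) * hε2 - σ * ε * ε * hδ2
  · simpa [hD] using hpos s hs

lemma IsArcLengthCurve.map_deriv_tangent (hα : IsArcLengthCurve α I) (hI : IsOpen I)
    (hκ : ∀ s ∈ I, 0 < curvature α s) (hl : IsOrdered l₁ l₂ l₃ σ)
    (hM : IsAdapted L l₁ l₂ l₃ σ M)
    (hL : ∀ s ∈ I, L (tangent α s) = curvature α s • binormal α s) {s : ℝ} (hs : s ∈ I) :
    M (curvature α s • normal α s) = σ • cross (M (L (tangent α s))) (M (tangent α s)) := by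
  have h := map_cross M (L (tangent α s)) (tangent α s)
  rw [hM.det] at h
  rw [h, smul_smul, hl.mul_self, one_smul, hL s hs, cross_smul_left, cross_swap, binormal,
    cross_cross_right, hα.inner_tangent_normal hI hκ hs, hα.inner_tangent_self hs]
  simp

/-- The semi-axes and the speed in terms of the eigenvalues. -/
lemma IsOrdered.axes (hl : IsOrdered l₁ l₂ l₃ σ) :
    ∃ A B k : ℝ, A = √(l₃ / (l₃ - l₁)) ∧ B = √(l₃ / (l₃ - l₂)) ∧ 0 < A ∧ A < 1 ∧ 0 < B ∧ B < 1 ∧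
      0 < k ∧ A * B * k = σ * l₃ ∧ B * k = A * (σ * l₃ - σ * l₁) ∧
      A * k = B * (σ * l₃ - σ * l₂) ∧ A ^ 2 * (l₃ - l₁) = l₃ ∧ B ^ 2 * (l₃ - l₂) = l₃ := by
  have hσ : σ ≠ 0 := by intro h; have := hl.pos; rw [h, zero_mul] at this; exact this.false
  have h3 := hl.pos
  have h2 := hl.neg
  have h1 : σ * l₁ < 0 := hl.le.trans_lt h2
  have e1 : l₃ / (l₃ - l₁) = σ * l₃ / (σ * l₃ - σ * l₁) := by
    rw [← mul_sub, mul_div_mul_left _ _ hσ]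
  have e2 : l₃ / (l₃ - l₂) = σ * l₃ / (σ * l₃ - σ * l₂) := by
    rw [← mul_sub, mul_div_mul_left _ _ hσ]
  have d1 : 0 < σ * l₃ - σ * l₁ := by linarith
  have d2 : 0 < σ * l₃ - σ * l₂ := by linarith
  have n1 : l₃ - l₁ ≠ 0 := by intro h; rw [← mul_sub, h, mul_zero] at d1; exact d1.false
  have n2 : l₃ - l₂ ≠ 0 := by intro h; rw [← mul_sub, h, mul_zero] at d2; exact d2.false
  set A := √(l₃ / (l₃ - l₁)) with hA
  set B := √(l₃ / (l₃ - l₂)) with hB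
  have hA0 : 0 < A := by rw [hA, e1]; exact Real.sqrt_pos.2 (div_pos h3 d1)
  have hB0 : 0 < B := by rw [hB, e2]; exact Real.sqrt_pos.2 (div_pos h3 d2)
  have hA1 : A < 1 := by
    rw [hA, e1, Real.sqrt_lt' one_pos, one_pow, div_lt_one d1]; linarith
  have hB1 : B < 1 := by
    rw [hB, e2, Real.sqrt_lt' one_pos, one_pow, div_lt_one d2]; linarith
  have hA2 : A ^ 2 = l₃ / (l₃ - l₁) := by
    rw [hA, Real.sq_sqrt]; rw [e1]; exact (div_pos h3 d1).le
  have hB2 : B ^ 2 = l₃ / (l₃ - l₂) := by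
    rw [hB, Real.sq_sqrt]; rw [e2]; exact (div_pos h3 d2).le
  have hA3 : A ^ 2 * (l₃ - l₁) = l₃ := by rw [hA2, div_mul_cancel₀ _ n1]
  have hB3 : B ^ 2 * (l₃ - l₂) = l₃ := by rw [hB2, div_mul_cancel₀ _ n2]
  refine ⟨A, B, σ * l₃ / (A * B), rfl, rfl, hA0, hA1, hB0, hB1, by positivity, ?_, ?_, ?_,
    hA3, hB3⟩
  · field_simp
  · field_simp
    linear_combination -hA3
  · field_simp
    linear_combination -hB3

end Coordinates

/-! ### The model curve -/

section Model

variable {A B k : ℝ}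

/-- The tangent vector of the model curve as a function of the angle. -/
def modelTangent (A B w : ℝ) : E3 := !₂[A * Real.cos w, B * Real.sin w, height A B w]

@[simp] lemma modelTangent_zero (w : ℝ) : modelTangent A B w 0 = A * Real.cos w := rfl
@[simp] lemma modelTangent_one (w : ℝ) : modelTangent A B w 1 = B * Real.sin w := rfl
@[simp] lemma modelTangent_two (w : ℝ) : modelTangent A B w 2 = height A B w := rfl

lemma contDiff_modelTangent (hA : 0 < A) (hA' : A < 1) (hB : 0 < B) (hB' : B < 1) :
    ContDiff ℝ ∞ (modelTangent A B) := by
  rw [contDiff_euclidean]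
  intro i
  fin_cases i
  · exact contDiff_const.mul Real.contDiff_cos
  · exact contDiff_const.mul Real.contDiff_sin
  · exact contDiff_height hA hA' hB hB'

lemma norm_modelTangent (hA : 0 < A) (hA' : A < 1) (hB : 0 < B) (hB' : B < 1) (w : ℝ) :
    ‖modelTangent A B w‖ = 1 := by
  have h : inner ℝ (modelTangent A B w) (modelTangent A B w) = (1 : ℝ) := by
    have := height_sq hA hA' hB hB' w
    rw [inner_eq]
    simp only [modelTangent_zero, modelTangent_one, modelTangent_two]
    linear_combination this
  rw [real_inner_self_eq_norm_sq] at h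
  exact (pow_eq_one_iff_of_nonneg (norm_nonneg _) two_ne_zero).1 h

lemma hasDerivAt_modelTangent (hA : 0 < A) (hA' : A < 1) (hB : 0 < B) (hB' : B < 1)
    (w : ℝ) : HasDerivAt (modelTangent A B)
      !₂[-(A * Real.sin w), B * Real.cos w,
        (A ^ 2 - B ^ 2) * Real.cos w * Real.sin w / height A B w] w := by
  rw [← hasDerivWithinAt_univ, hasDerivWithinAt_iff_hasFDerivWithinAt,
    hasFDerivWithinAt_euclidean]
  simp only [hasFDerivWithinAt_univ]
  intro i
  fin_cases i
  · refine ((Real.hasDerivAt_cos w).const_mul A).hasFDerivAt.congr_fderiv ?_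
    ext; simp
  · refine ((Real.hasDerivAt_sin w).const_mul B).hasFDerivAt.congr_fderiv ?_
    ext; simp
  · refine (hasDerivAt_height hA hA' hB hB' w).hasFDerivAt.congr_fderiv ?_
    ext; simp

end Model

section Curves

variable {α : ℝ → E3} {I : Set ℝ} {L : E3 →ₗ[ℝ] E3} {l₁ l₂ l₃ σ A B k : ℝ} {M : E3 ≃ₗᵢ[ℝ] E3}
  {W G : ℝ → ℝ}

/-- Up to a sign and a shift of the parameter, the tangent vectors are those of the model
curve. -/
lemma IsArcLengthCurve.exists_shift (hα : IsArcLengthCurve α I) (hI : IsOpen I)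
    (hI' : I.OrdConnected) (hIne : I.Nonempty)
    (hκ : ∀ s ∈ I, 0 < curvature α s) (hl : IsOrdered l₁ l₂ l₃ σ)
    (hM : IsAdapted L l₁ l₂ l₃ σ M)
    (hL : ∀ s ∈ I, L (tangent α s) = curvature α s • binormal α s)
    (hA : 0 < A) (hA' : A < 1) (hB : 0 < B) (hB' : B < 1) (hk : 0 < k)
    (hBk : B * k = A * (σ * l₃ - σ * l₁)) (hAk : A * k = B * (σ * l₃ - σ * l₂))
    (hA2 : A ^ 2 * (l₃ - l₁) = l₃) (hB2 : B ^ 2 * (l₃ - l₂) = l₃)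
    (hWG : ∀ w, W (G w) = w) (hG : ∀ w, HasDerivAt G (k * height A B w)⁻¹ w)
    {ε : ℝ} (hε : ε = 1 ∨ ε = -1) (hpos : ∀ s ∈ I, 0 < ε * M (tangent α s) 2) :
    ∃ c : ℝ, ∀ s ∈ I, M (tangent α s) = ε • modelTangent A B (W (ε * s + c)) := by
  have hd : ∀ s ∈ I, ∀ i, HasDerivAt (fun r => M (tangent α r) i)
      ((σ • cross (M (L (tangent α s))) (M (tangent α s))) i) s := fun s hs i => by
    rw [← hα.map_deriv_tangent hI hκ hl hM hL hs]
    exact hasDerivAt_coord M (hα.hasDerivAt_tangent hI hκ hs) i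
  have hl3 : l₃ ≠ 0 := by
    intro h; have := hl.pos; rw [h, mul_zero] at this; exact this.false
  obtain ⟨c, hc⟩ := exists_shift_of_system hA hA' hB hB' hk hWG hG hI hI' hIne hε
    (x := fun s => M (tangent α s) 0) (y := fun s => M (tangent α s) 1)
    (z := fun s => M (tangent α s) 2) (hα.continuousOn_coord hI M 2)
    (fun s hs => (hd s hs 0).congr_deriv (by
      have : A / B * k = σ * l₃ - σ * l₂ := by field_simp; linear_combination hAk
      simp only [PiLp.smul_apply, cross_zero, hM.one, hM.two, smul_eq_mul, this]
      ring))
    (fun s hs => (hd s hs 1).congr_deriv (by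
      have : B / A * k = σ * l₃ - σ * l₁ := by field_simp; linear_combination hBk
      simp only [PiLp.smul_apply, cross_one, hM.zero, hM.two, smul_eq_mul, this]
      ring))
    hpos
    (fun s hs => by
      have h1 := coord_quadric hM hL hs
      have h2 := hα.coord_sphere M hs
      refine mul_left_cancel₀ hl3 ?_
      have e1 : l₃ * (M (tangent α s) 0 / A) ^ 2 = (l₃ - l₁) * M (tangent α s) 0 ^ 2 := by
        field_simp; linear_combination (-M (tangent α s) 0 ^ 2) * hA2
      have e2 : l₃ * (M (tangent α s) 1 / B) ^ 2 = (l₃ - l₂) * M (tangent α s) 1 ^ 2 := by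
        field_simp; linear_combination (-M (tangent α s) 1 ^ 2) * hB2
      rw [mul_add, e1, e2]
      linear_combination l₃ * h2 - h1)
    (fun s hs => hα.coord_sphere M hs)
  refine ⟨c, fun s hs => ?_⟩
  obtain ⟨h0, h1, h2⟩ := hc s hs
  exact ext3 h0 h1 h2

/-- The square of the speed of the angle function. -/
lemma IsArcLengthCurve.curvature_sq_add (hα : IsArcLengthCurve α I) (hI : IsOpen I)
    (hκ : ∀ s ∈ I, 0 < curvature α s) (hl : IsOrdered l₁ l₂ l₃ σ)
    (hM : IsAdapted L l₁ l₂ l₃ σ M)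
    (hL : ∀ s ∈ I, L (tangent α s) = curvature α s • binormal α s)
    (hA : 0 < A) (hB : 0 < B) (hBk : B * k = A * (σ * l₃ - σ * l₁))
    (hAk : A * k = B * (σ * l₃ - σ * l₂)) {s : ℝ} (hs : s ∈ I) :
    curvature α s ^ 2 + l₁ * l₂ = (k * M (tangent α s) 2) ^ 2 := by
  have hk2 : k ^ 2 = (l₃ - l₁) * (l₃ - l₂) := by
    refine mul_left_cancel₀ (mul_pos hA hB).ne' ?_
    linear_combination (A * k) * hBk + A * (σ * l₃ - σ * l₁) * hAk
      + A * B * (l₃ - l₁) * (l₃ - l₂) * hl.mul_self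
  have h1 := coord_quadric hM hL hs
  have h2 := hα.coord_sphere M hs
  obtain ⟨-, -, -, -, -, -, -, -, e9⟩ := hα.frenet_inner hI hκ hs
  have h3 : inner ℝ (M (L (tangent α s))) (M (L (tangent α s))) = curvature α s ^ 2 := by
    rw [M.inner_map_map, hL s hs, inner_smul_left, inner_smul_right, e9, conj_trivial]
    ring
  rw [inner_eq, hM.zero, hM.one, hM.two] at h3
  rw [mul_pow, hk2, ← h3]
  linear_combination (l₁ + l₂) * h1 - l₁ * l₂ * h2

lemma hasNormalForm_of_tangent (hα : IsArcLengthCurve α I) (hI : IsOpen I)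
    (hI' : I.OrdConnected) (hκ : ∀ s ∈ I, 0 < curvature α s) (hl : IsOrdered l₁ l₂ l₃ σ)
    (hM : IsAdapted L l₁ l₂ l₃ σ M)
    (hL : ∀ s ∈ I, L (tangent α s) = curvature α s • binormal α s)
    (hAd : A = √(l₃ / (l₃ - l₁))) (hBd : B = √(l₃ / (l₃ - l₂)))
    (hA : 0 < A) (hA' : A < 1) (hB : 0 < B) (hB' : B < 1) (hk : 0 < k)
    (hBk : B * k = A * (σ * l₃ - σ * l₁)) (hAk : A * k = B * (σ * l₃ - σ * l₂))
    (hW : ∀ u, HasDerivAt W (k * height A B (W u)) u) {c : ℝ}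
    (hc : ∀ s ∈ I, M (tangent α s) = modelTangent A B (W (s + c))) :
    HasNormalForm l₁ l₂ l₃ M α I := by
  have hWc : Continuous W := continuous_iff_continuousAt.2 fun u => (hW u).continuousAt
  have hHc : Continuous (height A B) := (contDiff_height hA hA' hB hB').continuous
  refine ⟨fun s => W (s + c), fun s₀ hs₀ s hs => ?_, fun s₀ hs₀ => ?_⟩
  · have h1 : ∫ u in s₀..s, √(curvature α u ^ 2 + l₁ * l₂)
        = ∫ u in s₀..s, k * height A B (W (u + c)) := by
      refine intervalIntegral.integral_congr fun u hu => ?_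
      have huI := hI'.uIcc_subset hs₀ hs hu
      rw [hα.curvature_sq_add hI hκ hl hM hL hA hB hBk hAk huI, hc u huI, modelTangent_two,
        Real.sqrt_sq (mul_pos hk (height_pos hA hA' hB hB' _)).le]
    rw [h1, intervalIntegral.integral_eq_sub_of_hasDerivAt (f := fun s => W (s + c))
      (fun u _ => (hW (u + c)).comp_add_const u c)
      ((continuous_const.mul (hHc.comp (hWc.comp
        (continuous_id.add continuous_const)))).intervalIntegrable _ _)]
    ring
  · rw [← hAd, ← hBd]
    refine ⟨-M (α s₀), fun s hs => ?_⟩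
    have hTc : ∀ i, ContinuousOn (fun u => M (tangent α u) i) (Set.uIcc s₀ s) := fun i =>
      (hα.continuousOn_coord hI M i).mono (hI'.uIcc_subset hs₀ hs)
    have key : ∀ i, M (α s) i - M (α s₀) i = ∫ u in s₀..s, M (tangent α u) i := fun i =>
      (intervalIntegral.integral_eq_sub_of_hasDerivAt
        (fun u hu => hasDerivAt_coord M (hα.hasDerivAt hI (hI'.uIcc_subset hs₀ hs hu)) i)
        (hTc i).intervalIntegrable).symm
    have hcongr : ∀ i, ∫ u in s₀..s, M (tangent α u) i
        = ∫ u in s₀..s, modelTangent A B (W (u + c)) i := fun i =>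
      intervalIntegral.integral_congr fun u hu => by
        simp only [hc u (hI'.uIcc_subset hs₀ hs hu)]
    apply ext3
    · rw [PiLp.add_apply, PiLp.neg_apply, ← sub_eq_add_neg, key, hcongr]
      simp [modelCurve]
    · rw [PiLp.add_apply, PiLp.neg_apply, ← sub_eq_add_neg, key, hcongr]
      simp [modelCurve]
    · rw [PiLp.add_apply, PiLp.neg_apply, ← sub_eq_add_neg, key, hcongr]
      rfl

/-- The complete curve with given initial point and given tangent vectors. -/
lemma exists_completeCurve (hl : IsOrdered l₁ l₂ l₃ σ) (hM : IsAdapted L l₁ l₂ l₃ σ M)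
    (hA : 0 < A) (hA' : A < 1) (hB : 0 < B) (hB' : B < 1)
    (hABk : A * B * k = σ * l₃)
    (hBk : B * k = A * (σ * l₃ - σ * l₁)) (hAk : A * k = B * (σ * l₃ - σ * l₂))
    (hA2 : A ^ 2 * (l₃ - l₁) = l₃) (hB2 : B ^ 2 * (l₃ - l₂) = l₃)
    (hWs : ContDiff ℝ ∞ W) (hW : ∀ u, HasDerivAt W (k * height A B (W u)) u) (c s₀ : ℝ)
    (p : E3) :
    ∃ γ : ℝ → E3, IsArcLengthCurve γ Set.univ ∧ (∀ u, 0 < curvature γ u) ∧ γ s₀ = p ∧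
      (∀ u, HasDerivAt γ (M.symm (modelTangent A B (W (u + c)))) u) ∧
      (∀ u, L (tangent γ u) = curvature γ u • binormal γ u) := by
  set τ : ℝ → E3 := fun u => M.symm (modelTangent A B (W (u + c))) with hτ
  have hτs : ContDiff ℝ ∞ τ := M.symm.contDiff.comp
    ((contDiff_modelTangent hA hA' hB hB').comp (hWs.comp (contDiff_id.add contDiff_const)))
  set γ : ℝ → E3 := fun u => p + ∫ r in s₀..u, τ r with hγ
  have hd : ∀ u, HasDerivAt γ (τ u) u := fun u =>
    (hτs.continuous.integral_hasStrictDerivAt s₀ u).hasDerivAt.const_add p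
  have htan : tangent γ = τ := funext fun u => (hd u).deriv
  have hMτ : ∀ u, M (τ u) = modelTangent A B (W (u + c)) := fun u => M.apply_symm_apply _
  have hcurve : IsArcLengthCurve γ Set.univ := by
    refine ⟨?_, fun u _ => ?_⟩
    · rw [contDiffOn_univ, contDiff_infty_iff_deriv]
      refine ⟨fun u => (hd u).differentiableAt, ?_⟩
      change ContDiff ℝ ∞ (tangent γ)
      rwa [htan]
    · rw [(hd u).deriv, hτ, LinearIsometryEquiv.norm_map, norm_modelTangent hA hA' hB hB']
  have hτd : ∀ u, HasDerivAt τ (deriv τ u) u := fun u =>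
    (hτs.differentiable (by simp) u).hasDerivAt
  have hMd : ∀ u, M (deriv τ u) = (k * height A B (W (u + c))) •
      !₂[-(A * Real.sin (W (u + c))), B * Real.cos (W (u + c)),
        (A ^ 2 - B ^ 2) * Real.cos (W (u + c)) * Real.sin (W (u + c))
          / height A B (W (u + c))] := by
    intro u
    have h1 := hasDerivAt_map (M.toLinearEquiv : E3 →ₗ[ℝ] E3) (hτd u)
    have h2 := (hasDerivAt_modelTangent hA hA' hB hB' (W (u + c))).scomp u
      ((hW (u + c)).comp_add_const u c)
    refine h1.unique (h2.congr_of_eventuallyEq (Filter.Eventually.of_forall fun r => ?_))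
    exact hMτ r
  have hcross : ∀ u, cross (τ u) (deriv τ u) = L (τ u) := by
    intro u
    refine M.injective ?_
    have h1 := map_cross M (τ u) (deriv τ u)
    rw [hM.det] at h1
    have h2 : M (cross (τ u) (deriv τ u)) = σ • cross (M (τ u)) (M (deriv τ u)) := by
      rw [h1, smul_smul, hl.mul_self, one_smul]
    have hh := (height_pos hA hA' hB hB' (W (u + c))).ne'
    have hsq := height_sq hA hA' hB hB' (W (u + c))
    have hcs := Real.sin_sq_add_cos_sq (W (u + c))
    have hσσ := hl.mul_self
    rw [h2, hMd, cross_smul_right]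
    apply ext3
    · rw [hM.zero, hMτ]
      simp only [PiLp.smul_apply, cross_zero, smul_eq_mul, modelTangent_one, modelTangent_two,
        modelTangent_zero]
      simp
      generalize height A B (W (u + c)) = h at hh hsq ⊢
      generalize Real.sin (W (u + c)) = S at hsq hcs ⊢
      generalize Real.cos (W (u + c)) = C at hsq hcs ⊢
      have e : h * ((A ^ 2 - B ^ 2) * C * S / h) = (A ^ 2 - B ^ 2) * C * S :=
        mul_div_cancel₀ _ hh
      linear_combination σ * k * B * S * e - σ * k * B * C * hsq + σ * k * B * C * A ^ 2 * hcs
        + σ * C * (A ^ 2 - 1) * hBk + A * C * (l₃ - l₁) * (A ^ 2 - 1) * hσσ + A * C * hA2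
    · rw [hM.one, hMτ]
      simp only [PiLp.smul_apply, cross_one, smul_eq_mul, modelTangent_one, modelTangent_two,
        modelTangent_zero]
      simp
      generalize height A B (W (u + c)) = h at hh hsq ⊢
      generalize Real.sin (W (u + c)) = S at hsq hcs ⊢
      generalize Real.cos (W (u + c)) = C at hsq hcs ⊢
      have e : h * ((A ^ 2 - B ^ 2) * C * S / h) = (A ^ 2 - B ^ 2) * C * S :=
        mul_div_cancel₀ _ hh
      linear_combination (-σ * k * A * C) * e - σ * k * A * S * hsq + σ * k * A * S * B ^ 2 * hcs
        + σ * S * (B ^ 2 - 1) * hAk + B * S * (l₃ - l₂) * (B ^ 2 - 1) * hσσ + B * S * hB2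
    · rw [hM.two, hMτ]
      simp only [PiLp.smul_apply, cross_two, smul_eq_mul, modelTangent_one, modelTangent_two,
        modelTangent_zero]
      simp
      generalize height A B (W (u + c)) = h at hh hsq ⊢
      generalize Real.sin (W (u + c)) = S at hsq hcs ⊢
      generalize Real.cos (W (u + c)) = C at hsq hcs ⊢
      linear_combination σ * k * h * A * B * hcs + σ * h * hABk + l₃ * h * hσσ
  have hpos : ∀ u, 0 < curvature γ u := by
    intro u
    rw [curvature, htan, norm_pos_iff]
    intro h0
    have h1 := hcross u
    rw [h0] at h1
    have h2 := congrArg (fun v => M v 2) h1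
    have h3 : cross (τ u) 0 = 0 := by simp [cross]
    simp only [h3, map_zero, hM.two, hMτ, modelTangent_two] at h2
    have hl3 := hl.pos
    have hh := (height_pos hA hA' hB hB' (W (u + c))).ne'
    have : l₃ = 0 := (mul_eq_zero.1 h2.symm).resolve_right hh
    rw [this, mul_zero] at hl3
    exact hl3.false
  refine ⟨γ, hcurve, hpos, by simp [hγ], hd, fun u => ?_⟩
  rw [binormal, ← cross_smul_right, ← deriv_tangent_eq (hpos u), htan, hcross]

end Curves

section Conclusion

variable {α : ℝ → E3} {I : Set ℝ} {L : E3 →ₗ[ℝ] E3} {l₁ l₂ l₃ σ : ℝ}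

lemma IsArcLengthCurve.curvature_eq_norm (hα : IsArcLengthCurve α I) (hI : IsOpen I)
    (hκ : ∀ s ∈ I, 0 < curvature α s)
    (hL : ∀ s ∈ I, L (tangent α s) = curvature α s • binormal α s) {s : ℝ} (hs : s ∈ I) :
    curvature α s = ‖L (tangent α s)‖ := by
  obtain ⟨b, -, -, h2⟩ := hα.exists_frenetBasis hI hκ hs
  rw [hL s hs, norm_smul, ← h2, b.norm_eq_one, mul_one, Real.norm_of_nonneg (hκ s hs).le]

/-- The first integrals. -/
lemma IsArcLengthCurve.first_integrals (hα : IsArcLengthCurve α I) (hI : IsOpen I)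
    (hκ : ∀ s ∈ I, 0 < curvature α s)
    (hL : ∀ s ∈ I, L (tangent α s) = curvature α s • binormal α s) (hsymm : L.IsSymmetric)
    (hl : L.charpoly = (Polynomial.X - Polynomial.C l₁)
      * (Polynomial.X - Polynomial.C l₂) * (Polynomial.X - Polynomial.C l₃))
    (hne : l₁ * l₂ * l₃ ≠ 0) {s : ℝ} (hs : s ∈ I) :
    curvature α s ^ 2 * torsion α s = l₁ * l₂ * l₃ ∧
    bigSigma α s / torsion α s - torsion α s = l₁ + l₂ + l₃ ∧
    SolvesODEAt (l₁ * l₂ * l₃) (l₁ + l₂ + l₃) (l₁ * l₂ + l₁ * l₃ + l₂ * l₃) (curvature α) s := by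
  obtain ⟨h1, h2, h3⟩ := hα.charpoly_coeffs hI hκ hL hsymm hl hs
  have hκ0 := (hκ s hs).ne'
  have hτ : torsion α s ≠ 0 := fun h => hne (by rw [h1, h, mul_zero])
  refine ⟨h1.symm, ?_, ?_⟩
  · rw [hα.bigSigma_eq hI hκ hL hs, h2, mul_div_cancel_left₀ _ hτ]
  · rw [SolvesODEAt, h1, h2, h3]
    field_simp
    ring

lemma roots_cubic (l₁ l₂ l₃ : ℝ) :
    (cubic (l₁ * l₂ * l₃) (l₁ + l₂ + l₃) (l₁ * l₂ + l₁ * l₃ + l₂ * l₃)).roots = {l₁, l₂, l₃} := by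
  have h : cubic (l₁ * l₂ * l₃) (l₁ + l₂ + l₃) (l₁ * l₂ + l₁ * l₃ + l₂ * l₃)
      = -(({l₁, l₂, l₃} : Multiset ℝ).map fun a => Polynomial.X - Polynomial.C a).prod := by
    simp only [cubic, Multiset.insert_eq_cons, Multiset.map_cons, Multiset.prod_cons,
      Multiset.map_singleton, Multiset.prod_singleton, map_mul, map_add]
    ring
  rw [h, Polynomial.roots_neg, Polynomial.roots_multiset_prod_X_sub_C]

end Conclusion

end TranslationSurface

end

open TranslationSurface in
theorem theoremt44
    (I J : Set ℝ) (hI : IsOpen I) (hI' : I.OrdConnected) (hIne : I.Nonempty)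
    (hJ : IsOpen J) (hJ' : J.OrdConnected) (hJne : J.Nonempty)
    (α β : ℝ → TranslationSurface.E3)
    (hα : TranslationSurface.IsArcLengthCurve α I)
    (hβ : TranslationSurface.IsArcLengthCurve β J)
    (hmin : TranslationSurface.IsMinimalSurface (fun s t => α s + β t) I J)
    (hκα : ∀ s ∈ I, 0 < TranslationSurface.curvature α s)
    (hκβ : ∀ t ∈ J, 0 < TranslationSurface.curvature β t)
    (hτα : ∀ s ∈ I, TranslationSurface.torsion α s ≠ 0)
    (hτβ : ∀ t ∈ J, TranslationSurface.torsion β t ≠ 0) :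
    ∃ c₁ c₂ c₃ : ℝ, c₁ ≠ 0 ∧
      -- first integrals, with the same constants for both curves
      (∀ s ∈ I, TranslationSurface.curvature α s ^ 2 * TranslationSurface.torsion α s = c₁) ∧
      (∀ t ∈ J, TranslationSurface.curvature β t ^ 2 * TranslationSurface.torsion β t = c₁) ∧
      (∀ s ∈ I, TranslationSurface.bigSigma α s / TranslationSurface.torsion α s
        - TranslationSurface.torsion α s = c₂) ∧
      (∀ t ∈ J, TranslationSurface.bigSigma β t / TranslationSurface.torsion β t
        - TranslationSurface.torsion β t = c₂) ∧
      -- both curvatures solve the same autonomous equation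
      (∀ s ∈ I, TranslationSurface.SolvesODEAt c₁ c₂ c₃ (TranslationSurface.curvature α) s) ∧
      (∀ t ∈ J, TranslationSurface.SolvesODEAt c₁ c₂ c₃ (TranslationSurface.curvature β) t) ∧
      ∃ ε : ℝ, (ε = 1 ∨ ε = -1) ∧
        -- same orbit: `α` is a piece of a complete curve `γ`, and so is, up to a translation and
        -- a reparameterization `t ↦ ε t + t₁`, the curve `β`; in particular the curvatures are
        -- pieces of one global solution of the equation
        (∃ γ : ℝ → TranslationSurface.E3,
          TranslationSurface.IsArcLengthCurve γ Set.univ ∧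
          (∀ u, 0 < TranslationSurface.curvature γ u) ∧
          (∀ u, TranslationSurface.SolvesODEAt c₁ c₂ c₃ (TranslationSurface.curvature γ) u) ∧
          (∀ u, TranslationSurface.curvature γ u ^ 2 * TranslationSurface.torsion γ u = c₁) ∧
          (∀ s ∈ I, α s = γ s) ∧
          (∀ s ∈ I, TranslationSurface.curvature α s = TranslationSurface.curvature γ s) ∧
          ∃ (t₁ : ℝ) (v : TranslationSurface.E3),
            (∀ t ∈ J, β t = γ (ε * t + t₁) + v) ∧
            (∀ t ∈ J, TranslationSurface.curvature β t
              = TranslationSurface.curvature γ (ε * t + t₁))) ∧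
        -- normal form up to rigid motions
        ∃ l₁ l₂ l₃ : ℝ,
          (TranslationSurface.cubic c₁ c₂ c₃).roots = {l₁, l₂, l₃} ∧
          ∃ Mα Mβ : TranslationSurface.E3 ≃ₗᵢ[ℝ] TranslationSurface.E3,
            ((0 < c₁ ∧ l₁ ≤ l₂ ∧ l₂ < 0 ∧ 0 < l₃ ∧
                LinearMap.det (Mα.toLinearEquiv : TranslationSurface.E3 →ₗ[ℝ] _) = 1) ∨
              (c₁ < 0 ∧ l₁ ≥ l₂ ∧ l₂ > 0 ∧ 0 > l₃ ∧
                LinearMap.det (Mα.toLinearEquiv : TranslationSurface.E3 →ₗ[ℝ] _) = -1)) ∧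
            (∀ x, Mβ x = !₂[Mα x 0, ε * Mα x 1, ε * Mα x 2]) ∧
            TranslationSurface.HasNormalForm l₁ l₂ l₃ Mα α I ∧
            TranslationSurface.HasNormalForm l₁ l₂ l₃ Mβ β J := by
  obtain ⟨L, hLα, hLβ⟩ := hmin.exists_linearMap hI hJ hIne hJne hα hβ hκα hκβ hτα hτβ
  have hsymm : L.IsSymmetric := hα.isSymmetric hI hIne hκα hτα hLα
  rw [LinearMap.isSelfAdjoint_iff'.1 ((LinearMap.isSymmetric_iff_isSelfAdjoint L).1 hsymm)] at hLβ
  obtain ⟨a, ha⟩ := hIne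
  obtain ⟨l₁, l₂, l₃, σ, δ, M₀, hchar, hl, hM₀⟩ :=
    exists_isOrdered_isAdapted hsymm (hα.inner_tangent_self ha)
      (by rw [hLα a ha, inner_smul_right, binormal, inner_cross_left, mul_zero])
      fun l₁ l₂ l₃ h => by
        rw [(hα.charpoly_coeffs hI hκα hLα hsymm h ha).1]
        exact mul_ne_zero (pow_ne_zero 2 (hκα a ha).ne') (hτα a ha)
  have hne : l₁ * l₂ * l₃ ≠ 0 := by
    rw [(hα.charpoly_coeffs hI hκα hLα hsymm hchar ha).1]
    exact mul_ne_zero (pow_ne_zero 2 (hκα a ha).ne') (hτα a ha)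
  obtain ⟨M, hM, hMpos⟩ := hα.exists_isAdapted_pos hI hI' hl hM₀ hLα
  obtain ⟨ε, hε, hεpos⟩ := hβ.exists_sign hJ hJ' hl hM hLβ
  have hε2 : ε * ε = 1 := by rcases hε with h | h <;> rw [h] <;> norm_num
  obtain ⟨A, B, k, hAd, hBd, hA, hA', hB, hB', hk, hABk, hBk, hAk, hA2, hB2⟩ := hl.axes
  obtain ⟨W, G, hWs, hW, hWG, hG⟩ := exists_angle hA hA' hB hB' hk
  obtain ⟨D, hD, hDdet⟩ := exists_signs (Or.inl rfl) hε hε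
  have hMβ : IsAdapted L l₁ l₂ l₃ σ (M.trans D) := by
    have := hM.trans_signs hD hDdet
    rwa [one_mul, hε2, one_mul] at this
  obtain ⟨c, hc⟩ := hα.exists_shift hI hI' ⟨a, ha⟩ hκα hl hM hLα hA hA' hB hB' hk hBk hAk hA2 hB2
    hWG hG (Or.inl rfl) fun s hs => by simpa using hMpos s hs
  obtain ⟨c', hc'⟩ := hβ.exists_shift hJ hJ' hJne hκβ hl hM hLβ hA hA' hB hB' hk hBk hAk hA2 hB2
    hWG hG hε hεpos
  obtain ⟨d, hd⟩ := hβ.exists_shift hJ hJ' hJne hκβ hl hMβ hLβ hA hA' hB hB' hk hBk hAk hA2 hB2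
    hWG hG (Or.inl rfl) fun t ht => by simpa [hD] using hεpos t ht
  simp only [one_mul, one_smul] at hc hd
  obtain ⟨γ, hγ, hκγ, hγa, hγd, hLγ⟩ := exists_completeCurve hl hM hA hA' hB hB' hABk hBk hAk
    hA2 hB2 hWs hW c a (α a)
  have htγ : ∀ u, M (tangent γ u) = modelTangent A B (W (u + c)) := fun u => by
    rw [tangent, (hγd u).deriv, M.apply_symm_apply]
  have htα : ∀ s ∈ I, tangent α s = tangent γ s := fun s hs =>
    M.injective (by rw [hc s hs, htγ])
  have htβ : ∀ t ∈ J, tangent β t = ε • tangent γ (ε * t + (c' - c)) := fun t ht =>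
    M.injective (by rw [hc' t ht, map_smul, htγ, add_assoc, sub_add_cancel])
  have hγD : ∀ u, HasDerivAt γ (tangent γ u) u := fun u => (hγd u).differentiableAt.hasDerivAt
  have hαγ : ∀ s ∈ I, α s = γ s := fun s hs => by
    have h := eq_of_hasDerivAt_zero (f := fun s => α s - γ s) hI hI' (fun s hs =>
      ((hα.hasDerivAt hI hs).sub (hγD s)).congr_deriv (by rw [htα s hs, sub_self])) hs ha
    rw [hγa, sub_self] at h
    exact sub_eq_zero.1 h
  obtain ⟨b, hb⟩ := hJne
  have hβγ : ∀ t ∈ J, β t = γ (ε * t + (c' - c)) + (β b - γ (ε * b + (c' - c))) := fun t ht => by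
    have h := eq_of_hasDerivAt_zero (f := fun t => β t - γ (ε * t + (c' - c))) hJ hJ'
      (fun t ht => by
        have h1 : HasDerivAt (fun t => ε * t + (c' - c)) ε t := by
          simpa using ((hasDerivAt_id t).const_mul ε).add_const (c' - c)
        exact ((hβ.hasDerivAt hJ ht).sub ((hγD _).scomp t h1)).congr_deriv
          (by rw [htβ t ht, sub_self])) ht hb
    rw [← h, add_sub_cancel]
  have fα := fun s hs => hα.first_integrals hI hκα hLα hsymm hchar hne (s := s) hs
  have fβ := fun t ht => hβ.first_integrals hJ hκβ hLβ hsymm hchar hne (s := t) ht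
  have hκγ' : ∀ s ∈ Set.univ, 0 < curvature γ s := fun s _ => hκγ s
  have hLγ' : ∀ s ∈ Set.univ, L (tangent γ s) = curvature γ s • binormal γ s := fun s _ => hLγ s
  have fγ := fun u => hγ.first_integrals isOpen_univ hκγ' hLγ' hsymm hchar hne
    (s := u) (Set.mem_univ u)
  have nγ := fun u => hγ.curvature_eq_norm isOpen_univ hκγ' hLγ' (Set.mem_univ u)
  refine ⟨l₁ * l₂ * l₃, l₁ + l₂ + l₃, l₁ * l₂ + l₁ * l₃ + l₂ * l₃, hne, fun s hs => (fα s hs).1,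
    fun t ht => (fβ t ht).1, fun s hs => (fα s hs).2.1, fun t ht => (fβ t ht).2.1,
    fun s hs => (fα s hs).2.2, fun t ht => (fβ t ht).2.2, ε, hε,
    ⟨γ, hγ, hκγ, fun u => (fγ u).2.2, fun u => (fγ u).1, hαγ, fun s hs => ?_, c' - c, _, hβγ,
      fun t ht => ?_⟩,
    l₁, l₂, l₃, roots_cubic l₁ l₂ l₃, M, M.trans D, ?_, fun x => ?_, ?_, ?_⟩
  · rw [hα.curvature_eq_norm hI hκα hLα hs, htα s hs, nγ]
  · have hεn : ‖ε‖ = 1 := by rcases hε with h | h <;> rw [h] <;> norm_num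
    rw [hβ.curvature_eq_norm hJ hκβ hLβ ht, htβ t ht, map_smul, norm_smul, hεn, one_mul, nγ]
  · have hle := hl.le
    have hneg := hl.neg
    have hpos := hl.pos
    have hdet := hM.det
    rcases hl.sign with rfl | rfl
    · simp only [one_mul] at hle hneg hpos
      exact Or.inl ⟨mul_pos (mul_pos_of_neg_of_neg (hle.trans_lt hneg) hneg) hpos,
        hle, hneg, hpos, hdet⟩
    · have h1 : l₁ ≥ l₂ := by linarith
      have h2 : l₂ > 0 := by linarith
      have h3 : 0 > l₃ := by linarith
      exact Or.inr ⟨mul_neg_of_pos_of_neg (mul_pos (h2.trans_le h1) h2) h3, h1, h2, h3, hdet⟩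
  · simp [hD]
  · exact hasNormalForm_of_tangent hα hI hI' hκα hl hM hLα hAd hBd hA hA' hB hB' hk hBk hAk hW hc
  · exact hasNormalForm_of_tangent hβ hJ hJ' hκβ hl hMβ hLβ hAd hBd hA hA' hB hB' hk hBk hAk hW hd
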